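/- **Setting.** Let $\mathcal D_X$ be a probability measure on a measurable space $X$, let $H$ be a non-empty class of measurable hypotheses $h:X\to\{0,1\}$, put $\|h-h'\|=\Pr_{x\sim\mathcal D_X}[h(x)\ne h'(x)]$, let $B(\mu,R)$ be the closed ball of radius $R$ around $\mu\in H$, and let $N=N(H,\mathcal D_X,\eta)$ be the size of the smallest $\eta$-cover of $H$ by members of $H$, assumed finite. For a distribution $\lambda$ on finitely many members of $H$ let $r_\lambda(x)=\min\{\mathbb E_{h\sim\lambda}[h(x)],\,1-\mathbb E_{h\sim\lambda}[h(x)]\}$. A query distribution is a probability measure $q$ on $X$ with a bounded density $q(x)/\mathcal D_X(x)$; $\max_x q(x)/\mathcal D_X(x)$ denotes the essential supremum of the density. An active learner repeatedly draws a point $x$ from a query distribution of its choice and sees a fresh label $y\sim(Y\mid X=x)$; it *solves* $(H,\mathcal D_X,\eta,\varepsilon,\delta)$ with $m$ queries if, for every distribution of $(x,y)$ with marginal $\mathcal D_X$ such that some $h\in H$ has $\mathrm{err}(h)=\Pr[h(x)\ne y]\le\eta$, with probability at least $1-\delta$ it makes at most $m$ queries and outputs $\hat h\in H$ with $\mathrm{err}(\hat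 h)\le\eta+\varepsilon$. Write $\log^+t=\max\{1,\log t\}$. **Algorithm** (constants $\alpha,a,b,s>0$; $R=c_4\eta+c_5\varepsilon$). Compute a maximal $2\eta$-packing $H'\subseteq H$; put $w(h)=1$ for $h\in H'$ and $S=C=\emptyset$. Repeat $\lceil \frac a\beta\log^+\frac{|H'|}{\delta}\rceil$ times: let $\lambda=w/\sum_{H'}w$ and, for $S\subseteq H'$, let $\overline\lambda_S=\frac12\lambda$ on $S$ and $\overline\lambda_S=\lambda\cdot\frac{1-\lambda(S)/2}{1-\lambda(S)}$ on $H'\setminus S$; if some ball of radius $R$ has $\overline\lambda_S$-mass more than $80\%$, let $B(\mu',R)$, $\mu'\in H$, be a ball of radius $R$ of largest $\lambda$-mass, add $B(\mu',3R)\cap H'$ to $S$, and add $\mu'$ to $C$ (only the first $\lceil b\log^+\frac{|H'|}{\delta}\rceil$ centers are kept); choose a query distribution $q$ maximizing $\mathbb E_{x\sim q}[r_{\overline\lambda_S}(x)]-\frac{c_4}{20}\eta\max_x\frac{q(x)}{\mathcal D_X(x)}$ for the new $S$; query $x\sim q$, see $y$, and multiply $w(h)$ by $e^{-\alpha}$ for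 all $h\in H'$ with $h(x)\ne y$. Second stage: let $n=\lceil s\log^+\frac{|C|}{\delta}\rceil$ for the final $C$. As long as $C$ contains $h,h'$ with $\|h-h'\|>\eta+\varepsilon-(3\eta+3R)$, draw $n$ queries from $\mathcal D_X$ conditioned on $h(x)\ne h'(x)$ and remove from $C$ one of $h,h'$ that is wrong on at least half of them. Return any remaining member of $C$. **Theorem.** Let $c_4\ge300$, $c_5=\frac1{10}$ and $c_1>90c_4+80$. There are constants $\alpha,a,b,s>0$ and $K$, depending only on $c_1,c_4$, such that the following holds for all $X,\mathcal D_X,H$ as above and all $\eta\ge0$, $\varepsilon\ge c_1\eta$, $\delta\in(0,1)$, $\beta>0$. Suppose that for every distribution $\lambda$ on finitely many members of $H$ such that no ball of radius $c_4\eta+c_5\varepsilon$ centered in $H$ has $\lambda$-probability more than $80\%$, there is a query distribution $q$ with $$\mathbb E_{x\sim q}[r_\lambda(x)]-\frac{c_4}{20}\,\eta\,\max_x\frac{q(x)}{\mathcal D_X(x)}\ge\beta .$$ Then all objects that the algorithm has to choose exist, and, however ties are broken, the algorithm solves $(H,\mathcal D_X,\eta,\varepsilon,\delta)$ with at most $$K\left(\frac1\beta\log^+\frac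 N\delta+\log^+\frac N\delta\cdot\log^+\frac{\log^+N}{\delta}\right)$$ queries. -/

import Mathlib

open MeasureTheory ProbabilityTheory

noncomputable section

namespace ActiveLearning

/-- The logarithm as it is read inside `O(·)`-bounds: it is never smaller than `1`. -/
def logp (x : ℝ) : ℝ := max 1 (Real.log x)

/-! ### Active agnostic learning -/

/-- A randomized adaptive learner over the domain `X`: either it stops and outputs a hypothesis, or
it draws a point `x` from a query distribution `q` of its choice, is shown the label `y` of `x`,
and continues in a way that may depend on `x` and `y`. -/
inductive Learner (X : Type*) [MeasurableSpace X]
  | output (h : X → Bool) : Learner X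
  | query (q : Measure X) (next : X → Bool → Learner X) : Learner X

section Basic

variable {X : Type*} [MeasurableSpace X]

open Classical in
/-- The probability that a run of a learner, which has made `n` queries so far, ends with an output
`h` and a total number of queries `m` such that `E h m`. The label of a queried point `x` is a
fresh draw from `κ x`, the conditional law of the label given the point. -/
def Learner.prob (κ : Kernel X Bool) (E : (X → Bool) → ℕ → Prop) :
    Learner X → ℕ → ENNReal
  | .output h, n => if E h n then 1 else 0
  | .query q next, n => ∫⁻ x, ∫⁻ y, Learner.prob κ E (next x y) (n + 1) ∂(κ x) ∂q

/-- The distance `Pr_{x ∼ D}[h(x) ≠ h'(x)]`. -/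
def hdist (D : Measure X) (h h' : X → Bool) : ℝ := D.real {x | h x ≠ h' x}

/-- The error `Pr[h(x) ≠ y]` of `h` under the joint law of `(x, y)` with marginal `D` and
conditional label law `κ`. -/
def err (D : Measure X) (κ : Kernel X Bool) (h : X → Bool) : ℝ :=
  (D ⊗ₘ κ).real {p | h p.1 ≠ p.2}

/-- `A` solves the instance `(H, D, η, ε, δ)` with `m` queries. The joint distributions with
marginal `D` are `D ⊗ₘ κ` for Markov kernels `κ`. -/
def Solves (A : Learner X) (H : Set (X → Bool)) (D : Measure X) (η ε δ m : ℝ) : Prop :=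
  ∀ (κ : Kernel X Bool) [IsMarkovKernel κ], (∃ h ∈ H, err D κ h ≤ η) →
    ENNReal.ofReal (1 - δ) ≤
      A.prob κ (fun h n => (n : ℝ) ≤ m ∧ h ∈ H ∧ err D κ h ≤ η + ε) 0

/-- `F ⊆ H` is an `a`-cover of `H`. -/
def IsCover (D : Measure X) (H : Set (X → Bool)) (a : ℝ) (F : Finset (X → Bool)) : Prop :=
  (↑F : Set (X → Bool)) ⊆ H ∧ ∀ h ∈ H, ∃ h' ∈ F, hdist D h h' ≤ a

/-- `N(H, D, a)`: the size of the smallest (finite) `a`-cover of `H`. -/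
def coverNumber (D : Measure X) (H : Set (X → Bool)) (a : ℝ) : ℕ :=
  sInf {n | ∃ F, IsCover D H a F ∧ F.card = n}

/-- `F ⊆ H` is a maximal `a`-packing of `H`: distinct members are at distance more than `a`, and
no member of `H` can be added. -/
def IsMaxPacking (D : Measure X) (H : Set (X → Bool)) (a : ℝ) (F : Finset (X → Bool)) : Prop :=
  (↑F : Set (X → Bool)) ⊆ H ∧ (∀ h ∈ F, ∀ h' ∈ F, h ≠ h' → a < hdist D h h') ∧
    ∀ h ∈ H, h ∉ F → ∃ h' ∈ F, hdist D h h' ≤ a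

/-! ### Distributions on hypotheses and query distributions -/

/-- `lam` is a probability distribution on the finite set `F` of hypotheses. -/
def IsDistribution (F : Finset (X → Bool)) (lam : (X → Bool) → ℝ) : Prop :=
  (∀ h ∈ F, 0 ≤ lam h) ∧ ∑ h ∈ F, lam h = 1

open Classical in
/-- The mass that `lam`, carried by `F`, gives to the ball of radius `R` around `μ`. -/
def ballMass (D : Measure X) (F : Finset (X → Bool)) (lam : (X → Bool) → ℝ)
    (μ : X → Bool) (R : ℝ) : ℝ :=
  ∑ h ∈ F with hdist D h μ ≤ R, lam h

/-- `r(x) = min {E_{h ∼ lam}[h(x)], 1 - E_{h ∼ lam}[h(x)]}`. -/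
def minority (F : Finset (X → Bool)) (lam : (X → Bool) → ℝ) (x : X) : ℝ :=
  min (∑ h ∈ F with h x = true, lam h) (1 - ∑ h ∈ F with h x = true, lam h)

/-- `q` is a probability measure whose density `q(x) / D(x)` exists and is bounded. -/
def IsQueryDist (D q : Measure X) : Prop :=
  IsProbabilityMeasure q ∧ q ≪ D ∧ essSup (q.rnDeriv D) D ≠ ⊤

/-- `max_x q(x) / D(x)`. -/
def maxRatio (D q : Measure X) : ℝ := (essSup (q.rnDeriv D) D).toReal

/-- `E_{x ∼ q}[r(x)] - a · max_x q(x) / D(x)`. -/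
def queryValue (D : Measure X) (a : ℝ) (r : X → ℝ) (q : Measure X) : ℝ :=
  ∫ x, r x ∂q - a * maxRatio D q

/-- `q` maximizes `E_{x ∼ q}[r(x)] - a · max_x q(x) / D(x)` among the query distributions. -/
def IsOptimalQuery (D : Measure X) (a : ℝ) (r : X → ℝ) (q : Measure X) : Prop :=
  IsQueryDist D q ∧ ∀ q', IsQueryDist D q' → queryValue D a r q' ≤ queryValue D a r q

/-- Every distribution on (finitely many members of) `H` that gives no ball of radius
`c₄ η + c₅ ε` centered in `H` more than `80%` admits a query distribution of value at least `β`. -/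
def HasQueryValue (D : Measure X) (H : Set (X → Bool)) (c₄ c₅ η ε β : ℝ) : Prop :=
  ∀ (F : Finset (X → Bool)) (lam : (X → Bool) → ℝ), (↑F : Set (X → Bool)) ⊆ H →
    IsDistribution F lam →
    (∀ μ ∈ H, ballMass D F lam μ (c₄ * η + c₅ * ε) ≤ 4 / 5) →
    ∃ q, IsQueryDist D q ∧ β ≤ queryValue D (c₄ / 20 * η) (minority F lam) q

/-! ### The algorithm -/

/-- `w(h) / ∑_{h' ∈ F} w(h')`. -/
def posterior (F : Finset (X → Bool)) (w : (X → Bool) → ℝ) (h : X → Bool) : ℝ :=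
  w h / ∑ h' ∈ F, w h'

open Classical in
/-- The distribution `lam` capped on the set `S`. -/
def capped (lam : (X → Bool) → ℝ) (S : Finset (X → Bool)) (h : X → Bool) : ℝ :=
  if h ∈ S then 1 / 2 * lam h
  else lam h * ((1 - 1 / 2 * ∑ h' ∈ S, lam h') / (1 - ∑ h' ∈ S, lam h'))

end Basic

/-- The numerical constants of the algorithm: the step size `α` of the multiplicative update, and
the constant factors in the number of rounds, in the number of centers that are kept, and in the
number of samples per comparison in the second stage. -/
structure Constants where
  α : ℝ
  rounds : ℝ
  centers : ℝ
  samples : ℝ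

/-- What the algorithm computes without querying, where its description leaves the result open only
up to ties: a maximal `2η`-packing `H'`; for all weights `w` on `H'`, the center in `H` of a
heaviest ball of radius `R`; for all weights and all capped sets `S`, an optimal query distribution
(penalty factor `a`); in the second stage, some pair of candidates at distance more than `T` as long
as there is one, and some remaining candidate in the end. -/
structure Choices {X : Type*} [MeasurableSpace X] (D : Measure X) (H : Set (X → Bool))
    (η R a T : ℝ) where
  packing : Finset (X → Bool)
  packing_spec : IsMaxPacking D H (2 * η) packing
  center : ((X → Bool) → ℝ) → (X → Bool)
  center_mem : ∀ w, center w ∈ H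
  center_heaviest : ∀ w, ∀ μ ∈ H,
    ballMass D packing (posterior packing w) μ R ≤
      ballMass D packing (posterior packing w) (center w) R
  queryDist : ((X → Bool) → ℝ) → Finset (X → Bool) → Measure X
  queryDist_optimal : ∀ w, ∀ S ⊆ packing,
    IsOptimalQuery D a (minority packing (capped (posterior packing w) S)) (queryDist w S)
  pair : Finset (X → Bool) → (X → Bool) × (X → Bool)
  pair_spec : ∀ C : Finset (X → Bool), (∃ h ∈ C, ∃ h' ∈ C, T < hdist D h h') →
    (pair C).1 ∈ C ∧ (pair C).2 ∈ C ∧ T < hdist D (pair C).1 (pair C).2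
  pick : Finset (X → Bool) → (X → Bool)
  pick_mem : ∀ C : Finset (X → Bool), C.Nonempty → pick C ∈ C

section Algorithm

variable {X : Type*} [MeasurableSpace X] {D : Measure X} {H : Set (X → Bool)} {η R a T : ℝ}

/-- Draw `n` queries from `q`, add the number of mistakes of `h` to `m`, and go on with the
result. -/
def countMistakes (q : Measure X) (h : X → Bool) (next : ℕ → Learner X) : ℕ → ℕ → Learner X
  | 0, m => next m
  | n + 1, m => .query q fun x y =>
      countMistakes q h next n (if h x = y then m else m + 1)

open Classical in
/-- The second stage, on the candidates `C` and with at most `j` comparisons: as long as two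
candidates `h, h'` are at distance more than `T`, draw `n` samples from `D` conditioned on
`h(x) ≠ h'(x)` and remove one of the two that is wrong on at least half of them; then return a
remaining candidate. -/
def stageTwo (ch : Choices D H η R a T) (n : ℕ) : ℕ → Finset (X → Bool) → Learner X
  | 0, C => .output (ch.pick C)
  | j + 1, C =>
      if ∃ h ∈ C, ∃ h' ∈ C, T < hdist D h h' then
        countMistakes (cond D {x | (ch.pair C).1 x ≠ (ch.pair C).2 x}) (ch.pair C).1
          (fun m => stageTwo ch n j
            (C.erase (if n ≤ 2 * m then (ch.pair C).1 else (ch.pair C).2))) n 0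
      else .output (ch.pick C)

open Classical in
/-- The capped set after the test of a round: if some ball of radius `R` has more than `80%` under
the capped distribution, the ball of radius `3R` around the center of the heaviest ball is added. -/
def nextS (ch : Choices D H η R a T) (w : (X → Bool) → ℝ) (S : Finset (X → Bool)) :
    Finset (X → Bool) :=
  if ∃ μ ∈ H, 4 / 5 < ballMass D ch.packing (capped (posterior ch.packing w) S) μ R then
    S ∪ ch.packing.filter fun h => hdist D h (ch.center w) ≤ 3 * R
  else S

open Classical in
/-- The set of centers after the test of a round; only the first `cap` centers are kept. -/
def nextC (ch : Choices D H η R a T) (cap : ℕ) (w : (X → Bool) → ℝ)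
    (S C : Finset (X → Bool)) : Finset (X → Bool) :=
  if (∃ μ ∈ H, 4 / 5 < ballMass D ch.packing (capped (posterior ch.packing w) S) μ R) ∧
      C.card < cap then
    insert (ch.center w) C
  else C

open Classical in
/-- The multiplicative update of the weights on the packing `F` after the label `y` of `x` was
seen. -/
def nextW (F : Finset (X → Bool)) (α : ℝ) (w : (X → Bool) → ℝ) (x : X) (y : Bool)
    (h : X → Bool) : ℝ :=
  if h ∈ F ∧ h x ≠ y then Real.exp (-α) * w h else w h

/-- The first stage with `k` rounds left, current weights `w`, capped set `S` and centers `C`,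
followed by `finish`, applied to the centers found. -/
def stageOne (ch : Choices D H η R a T) (α : ℝ) (cap : ℕ)
    (finish : Finset (X → Bool) → Learner X) :
    ℕ → ((X → Bool) → ℝ) → Finset (X → Bool) → Finset (X → Bool) → Learner X
  | 0, _, _, C => finish C
  | k + 1, w, S, C =>
      .query (ch.queryDist w (nextS ch w S)) fun x y =>
        stageOne ch α cap finish k (nextW ch.packing α w x y) (nextS ch w S)
          (nextC ch cap w S C)

/-- The whole algorithm: about `(1/β) log (|H'|/δ)` rounds of the first stage, of which the first
`O(log (|H'|/δ))` centers are passed to the second stage, with `O(log (|C|/δ))` samples per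
comparison. -/
def algorithm (ch : Choices D H η R a T) (p : Constants) (β δ : ℝ) : Learner X :=
  stageOne ch p.α ⌈p.centers * logp (ch.packing.card / δ)⌉₊
    (fun C => stageTwo ch ⌈p.samples * logp (C.card / δ)⌉₊ C.card C)
    ⌈p.rounds * (1 / β) * logp (ch.packing.card / δ)⌉₊ (fun _ => 1) ∅ ∅

end Algorithm

/-- The distance threshold of the second stage. The centers found by the first stage contain one
within `3R` of a hypothesis of error at most `3η`, hence of error at most `3η + 3R`; a candidate
within the threshold of that one has error at most `η + ε`. -/
def threshold (η ε R : ℝ) : ℝ := η + ε - (3 * η + 3 * R)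

end ActiveLearning

end

namespace ActiveLearning

variable {X : Type*} [MeasurableSpace X] {D : Measure X} {H : Set (X → Bool)}

/-! ### Distances and errors -/

/-! Fix a hypothesis of error at most `η` and a member `t` of the packing within `2η` of it, so that
`err t ≤ 3η`. It suffices that the first stage, with high probability, keeps a center within `3R` of
`t`, and that the second stage does not lose it.

First stage. While `t` is not capped, follow the potential `1 / (λ(t) · λ(t | Sᶜ))`. It starts at
`|H'|²` and is always at least `1`. The capped distribution is the average of `λ` and `λ(· | Sᶜ)`,
so two things push the potential down. Labels: if hypotheses of capped mass `s` disagree with `t` at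
the query and `t` errs there with probability `ρ`, the mean factor is at most `1 - 19/100 s + 43/100
ρ` (`potential_nextW_le`, `mean_update_le`). Under an optimal query the penalty on the density pays
for the noise, and the factor is at most `exp(-β/10)` (`integral_mean_update_le`). The assumption on
`β` applies because no ball is heavy after the test (`ballMass_capped_nextS_le`). Caps: a set with
more than 80% of an average has more than 60% of both parts. Such a ball therefore meets the
heaviest ball and lies within `3R` of its center. Capping it removes more than 60% of the free
weight and multiplies the potential by at most `2/5` (`potential_nextS_le`). Hence the failure
probability is at most the potential times `exp(-β/10)^k + (2/5)^j`, with `k` rounds and `j` free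
places for centers left (`ofReal_le_prob_stageOne`). Logarithmically many centers suffice, and the
only other way for `t` to leave the analysis is to be capped, which puts a center within `3R` of it.

Second stage. The good center has error below half of the threshold `T`. Conditioned on a
disagreement set of probability more than `T`, its error stays below `1/2` by a fixed margin `g`,
and a Chernoff bound protects it in each of the at most `|C|` comparisons
(`ofReal_le_prob_stageTwo`). Every candidate that can be returned is then within `T` of it. -/

lemma hdist_comm (D : Measure X) (h g : X → Bool) : hdist D h g = hdist D g h := by
  simp only [hdist, ne_comm]

lemma hdist_triangle [IsFiniteMeasure D] (h g k : X → Bool) :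
    hdist D h k ≤ hdist D h g + hdist D g k := by
  refine (measureReal_mono ?_).trans (measureReal_union_le _ _)
  intro x hx
  by_cases hg : h x = g x
  · exact Or.inr fun e => hx (hg.trans e)
  · exact Or.inl hg

lemma measurableSet_ne {h g : X → Bool} (hh : Measurable h) (hg : Measurable g) :
    MeasurableSet {x | h x ≠ g x} :=
  (measurableSet_eq_fun hh hg).compl

/-- The conditional probability that `h` errs at the point `x`. -/
noncomputable def noise (κ : Kernel X Bool) (h : X → Bool) (x : X) : ℝ := (κ x).real {y | h x ≠ y}

lemma noise_nonneg (κ : Kernel X Bool) (h : X → Bool) (x : X) : 0 ≤ noise κ h x :=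
  measureReal_nonneg

lemma noise_le_one (κ : Kernel X Bool) [IsMarkovKernel κ] (h : X → Bool) (x : X) :
    noise κ h x ≤ 1 := measureReal_le_one

lemma measurableSet_mistakes {h : X → Bool} (hh : Measurable h) :
    MeasurableSet {p : X × Bool | h p.1 ≠ p.2} :=
  measurableSet_ne (hh.comp measurable_fst) measurable_snd

lemma measurable_noise (κ : Kernel X Bool) [IsMarkovKernel κ] {h : X → Bool} (hh : Measurable h) :
    Measurable (noise κ h) :=
  (Kernel.measurable_kernel_prodMk_left (κ := κ) (measurableSet_mistakes hh)).ennreal_toReal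

lemma integrable_noise (κ : Kernel X Bool) [IsMarkovKernel κ] {h : X → Bool} (hh : Measurable h)
    (q : Measure X) [IsFiniteMeasure q] : Integrable (noise κ h) q :=
  Integrable.of_bound (measurable_noise κ hh).aestronglyMeasurable 1
    (Filter.Eventually.of_forall fun x => by
      rw [Real.norm_eq_abs, abs_of_nonneg (noise_nonneg κ h x)]; exact noise_le_one κ h x)

lemma err_eq_integral_noise [IsProbabilityMeasure D] (κ : Kernel X Bool) [IsMarkovKernel κ]
    {h : X → Bool} (hh : Measurable h) : err D κ h = ∫ x, noise κ h x ∂D := by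
  have hm := Kernel.measurable_kernel_prodMk_left (κ := κ) (measurableSet_mistakes hh)
  rw [err, measureReal_def, Measure.compProd_apply (measurableSet_mistakes hh)]
  exact (integral_toReal hm.aemeasurable
    (Filter.Eventually.of_forall fun x => measure_lt_top _ _)).symm

lemma err_le_err_add_hdist [IsProbabilityMeasure D] (κ : Kernel X Bool) [IsMarkovKernel κ]
    {h g : X → Bool} (hh : Measurable h) (hg : Measurable g) :
    err D κ h ≤ err D κ g + hdist D g h := by
  have hsub : {p : X × Bool | h p.1 ≠ p.2} ⊆
      {p | g p.1 ≠ p.2} ∪ Prod.fst ⁻¹' {x | g x ≠ h x} := by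
    intro p hp
    by_cases e : g p.1 = p.2
    · exact Or.inr fun e' => hp (e'.symm.trans e)
    · exact Or.inl e
  have hd : hdist D g h = (D ⊗ₘ κ).real (Prod.fst ⁻¹' {x | g x ≠ h x}) := by
    rw [hdist, measureReal_def, measureReal_def, ← Measure.fst_apply (measurableSet_ne hg hh),
      Measure.fst_compProd]
  rw [hd]
  exact (measureReal_mono hsub).trans (measureReal_union_le _ _)

/-! ### Query distributions -/

lemma maxRatio_nonneg (D q : Measure X) : 0 ≤ maxRatio D q := ENNReal.toReal_nonneg

lemma IsQueryDist.le_smul [IsProbabilityMeasure D] {q : Measure X} (hq : IsQueryDist D q) :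
    q ≤ essSup (q.rnDeriv D) D • D := by
  have := hq.1
  conv_lhs => rw [← Measure.withDensity_rnDeriv_eq q D hq.2.1]
  rw [← withDensity_const]
  exact withDensity_mono (ENNReal.ae_le_essSup _)

/-- Applied to the noise of `t`, this bounds the error under `q` by the density bound times the
error under `D`. The penalty term in the query value is there to pay for it. -/
lemma IsQueryDist.integral_le [IsProbabilityMeasure D] {q : Measure X} (hq : IsQueryDist D q)
    {f : X → ℝ} (hf0 : ∀ x, 0 ≤ f x) (hf : Integrable f D) :
    ∫ x, f x ∂q ≤ maxRatio D q * ∫ x, f x ∂D := by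
  have h := integral_mono_measure hq.le_smul (Filter.Eventually.of_forall hf0)
    (hf.smul_measure hq.2.2)
  rwa [integral_smul_measure, smul_eq_mul] at h

lemma cond_eq_withDensity (D : Measure X) {A : Set X} (hA : MeasurableSet A) :
    cond D A = D.withDensity ((D A)⁻¹ • A.indicator 1) := by
  rw [withDensity_smul _ (measurable_one.indicator hA), withDensity_indicator_one hA]
  rfl

lemma essSup_rnDeriv_cond_le [IsProbabilityMeasure D] {A : Set X} (hA : MeasurableSet A) :
    essSup ((cond D A).rnDeriv D) D ≤ (D A)⁻¹ := by
  refine essSup_le_of_ae_le _ ?_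
  rw [cond_eq_withDensity D hA]
  filter_upwards [Measure.rnDeriv_withDensity D
    ((measurable_one.indicator hA).const_smul ((D A)⁻¹))] with x hx
  rw [hx]
  by_cases hxA : x ∈ A <;> simp [hxA]

lemma isQueryDist_cond [IsProbabilityMeasure D] {A : Set X} (hA : MeasurableSet A)
    (hA0 : D A ≠ 0) : IsQueryDist D (cond D A) :=
  ⟨cond_isProbabilityMeasure hA0, cond_absolutelyContinuous,
    ne_top_of_le_ne_top (ENNReal.inv_ne_top.2 hA0) (essSup_rnDeriv_cond_le hA)⟩

lemma integral_cond {A : Set X} (f : X → ℝ) :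
    ∫ x, f x ∂(cond D A) = (D.real A)⁻¹ * ∫ x in A, f x ∂D := by
  rw [ProbabilityTheory.cond, integral_smul_measure, smul_eq_mul, ENNReal.toReal_inv,
    measureReal_def]

lemma le_queryValue_cond [IsProbabilityMeasure D] {A : Set X} (hA : MeasurableSet A)
    (hA0 : D A ≠ 0) {a : ℝ} (ha : 0 ≤ a) (r : X → ℝ) :
    (D.real A)⁻¹ * (∫ x in A, r x ∂D - a) ≤ queryValue D a r (cond D A) := by
  have h : maxRatio D (cond D A) ≤ (D.real A)⁻¹ := by
    rw [measureReal_def, ← ENNReal.toReal_inv]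
    exact ENNReal.toReal_mono (ENNReal.inv_ne_top.2 hA0) (essSup_rnDeriv_cond_le hA)
  rw [queryValue, integral_cond]
  nlinarith [mul_le_mul_of_nonneg_left h ha]

/-- For a measurable function with finitely many values there is an optimal query distribution,
namely the restriction of `D` to a superlevel set. -/
lemma exists_isOptimalQuery [IsProbabilityMeasure D] {a : ℝ} (ha : 0 ≤ a) {r : X → ℝ}
    (hr : Measurable r) (hfin : (Set.range r).Finite) : ∃ q, IsOptimalQuery D a r q := by
  classical
  have hX : Nonempty X := nonempty_of_isProbabilityMeasure D
  let A : ℝ → Set X := fun t => {x | t ≤ r x}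
  have hA : ∀ t, MeasurableSet (A t) := fun t => measurableSet_le measurable_const hr
  let B : Finset ℝ := hfin.toFinset.filter fun t => D (A t) ≠ 0
  have hint : ∀ (q : Measure X) [IsFiniteMeasure q], Integrable r q := by
    intro q _
    obtain ⟨M, hM⟩ := (hfin.image fun t => ‖t‖).bddAbove
    refine Integrable.of_bound hr.aestronglyMeasurable M (Filter.Eventually.of_forall fun x => ?_)
    exact hM ⟨r x, ⟨x, rfl⟩, rfl⟩
  have hB : B.Nonempty := by
    obtain ⟨t, ht, hmin⟩ := Finset.exists_min_image hfin.toFinset id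
      ⟨r hX.some, by simp⟩
    refine ⟨t, Finset.mem_filter.2 ⟨ht, ?_⟩⟩
    have : A t = Set.univ := Set.eq_univ_of_forall fun x => hmin (r x) (by simp)
    simp [this]
  obtain ⟨t, htB, hmax⟩ := Finset.exists_max_image B
    (fun t => (D.real (A t))⁻¹ * (∫ x in A t, r x ∂D - a)) hB
  have ht0 : D (A t) ≠ 0 := (Finset.mem_filter.1 htB).2
  set V := (D.real (A t))⁻¹ * (∫ x in A t, r x ∂D - a) with hV
  -- A dual certificate for the value `V`. The set where `r > V` is null or is itself one of the
  -- superlevel sets compared, so its value is at most `V`. For any `q'`, integrating `r - V ≤ (r -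
  -- V)⁺` and using the density bound then gives a value of at most `V`.
  have hpos : ∫ x, max (r x - V) 0 ∂D ≤ a := by
    by_cases h0 : D {x | V < r x} = 0
    · have : (fun x => max (r x - V) 0) =ᵐ[D] 0 := by
        filter_upwards [measure_eq_zero_iff_ae_notMem.1 h0] with x hx
        have : r x ≤ V := not_lt.1 hx
        simpa using this
      rw [integral_congr_ae this]
      simpa using ha
    · obtain ⟨x₀, hx₀⟩ := nonempty_of_measure_ne_zero h0
      obtain ⟨u, hu, humin⟩ := Finset.exists_min_image
        (hfin.toFinset.filter fun u => V < u) id ⟨r x₀, by simpa using hx₀⟩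
      have huV : V < u := (Finset.mem_filter.1 hu).2
      have hAu : A u = {x | V < r x} := by
        ext x
        refine ⟨fun hx => lt_of_lt_of_le huV hx, fun hx => humin (r x) ?_⟩
        simpa using hx
      have huB : u ∈ B := Finset.mem_filter.2 ⟨(Finset.mem_filter.1 hu).1, by rwa [hAu]⟩
      have hle := hmax u huB
      have hu0 : 0 < D.real (A u) :=
        ENNReal.toReal_pos (by rwa [hAu]) (measure_ne_top _ _)
      rw [inv_mul_le_iff₀ hu0] at hle
      have heq : ∫ x, max (r x - V) 0 ∂D = ∫ x in A u, (r x - V) ∂D := by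
        rw [← integral_indicator (hA u)]
        refine integral_congr_ae (Filter.Eventually.of_forall fun x => ?_)
        by_cases hx : V < r x
        · have hxA : x ∈ A u := by rw [hAu]; exact hx
          simp [hxA, hx.le]
        · have hxA : x ∉ A u := by rw [hAu]; exact hx
          simp [hxA, not_lt.1 hx]
      rw [heq, integral_sub (hint D).integrableOn (integrable_const _), setIntegral_const,
        smul_eq_mul]
      linarith
  refine ⟨cond D (A t), isQueryDist_cond (hA t) ht0, fun q' hq' => ?_⟩
  refine le_trans ?_ (le_queryValue_cond (hA t) ht0 ha r)
  have := hq'.1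
  have hposint : Integrable (fun x => max (r x - V) 0) D :=
    ((hint D).sub (integrable_const V)).pos_part
  have h1 : ∫ x, (r x - V) ∂q' ≤ ∫ x, max (r x - V) 0 ∂q' :=
    integral_mono ((hint q').sub (integrable_const V))
      (((hint q').sub (integrable_const V)).pos_part) fun x => le_max_left _ _
  have h2 := hq'.integral_le (fun x => le_max_right (r x - V) 0) hposint
  have h3 := mul_le_mul_of_nonneg_left hpos (maxRatio_nonneg D q')
  rw [integral_sub (hint q') (integrable_const _), integral_const] at h1
  simp only [probReal_univ, smul_eq_mul, one_mul] at h1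
  rw [queryValue, ← hV]
  linarith

lemma measurable_sum_filter {F : Finset (X → Bool)} (hF : ∀ h ∈ F, Measurable h)
    (lam : (X → Bool) → ℝ) {g : X → Bool} (hg : Measurable g) :
    Measurable fun x => ∑ h ∈ F with h x = g x, lam h := by
  simp only [Finset.sum_filter]
  exact Finset.measurable_sum _ fun h hh =>
    Measurable.ite (measurableSet_eq_fun (hF h hh) hg) measurable_const measurable_const

lemma measurable_minority {F : Finset (X → Bool)} (hF : ∀ h ∈ F, Measurable h)
    (lam : (X → Bool) → ℝ) : Measurable (minority F lam) := by
  have h := measurable_sum_filter hF lam (measurable_const (a := true))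
  exact h.min (measurable_const.sub h)

lemma finite_range_minority {X : Type*} (F : Finset (X → Bool)) (lam : (X → Bool) → ℝ) :
    (Set.range (minority F lam)).Finite := by
  classical
  refine (F.powerset.image fun G =>
    min (∑ h ∈ G, lam h) (1 - ∑ h ∈ G, lam h)).finite_toSet.subset ?_
  rintro _ ⟨x, rfl⟩
  exact Finset.mem_image.2 ⟨_, Finset.mem_powerset.2 (Finset.filter_subset (fun h => h x = true) F),
    rfl⟩

/-! ### Packings and covers -/

/-- Two members of the packing assigned to the same element of the cover would be within `2η` of
each other. -/
lemma card_le_card_of_packing_of_cover [IsFiniteMeasure D] {η : ℝ} {P F : Finset (X → Bool)}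
    (hPH : (↑P : Set (X → Bool)) ⊆ H)
    (hP : ∀ h ∈ P, ∀ h' ∈ P, h ≠ h' → 2 * η < hdist D h h') (hF : IsCover D H η F) :
    P.card ≤ F.card := by
  choose! f hfF hf using hF.2
  refine Finset.card_le_card_of_injOn f (fun h hh => hfF h (hPH hh)) ?_
  intro h hh h' hh' e
  by_contra hne
  have h1 := hP h hh h' hh' hne
  have h2 := hdist_triangle (D := D) h (f h) h'
  have h3 := hf h (hPH hh)
  have h4 := hf h' (hPH hh')
  rw [hdist_comm, ← e] at h4
  linarith

lemma exists_isMaxPacking [IsFiniteMeasure D] {η : ℝ} {F : Finset (X → Bool)}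
    (hF : IsCover D H η F) : ∃ P, IsMaxPacking D H (2 * η) P := by
  classical
  let p : ℕ → Prop := fun n => ∃ P : Finset (X → Bool), (↑P : Set (X → Bool)) ⊆ H ∧
    (∀ h ∈ P, ∀ h' ∈ P, h ≠ h' → 2 * η < hdist D h h') ∧ P.card = n
  have hp0 : p 0 := ⟨∅, by simp, by simp, rfl⟩
  have hpb : ∀ n, p n → n ≤ F.card := by
    rintro n ⟨P, hPH, hP, rfl⟩
    exact card_le_card_of_packing_of_cover hPH hP hF
  obtain ⟨P, hPH, hP, hcard⟩ := Nat.findGreatest_spec (P := p) (Nat.zero_le F.card) hp0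
  refine ⟨P, hPH, hP, fun h hh hhP => ?_⟩
  by_contra! hfar
  have hp : p (P.card + 1) := by
    refine ⟨insert h P, ?_, ?_, Finset.card_insert_of_notMem hhP⟩
    · rw [Finset.coe_insert]
      exact Set.insert_subset hh hPH
    · intro g hg g' hg' hne
      rcases Finset.mem_insert.1 hg with rfl | hgP <;>
        rcases Finset.mem_insert.1 hg' with rfl | hgP'
      · exact absurd rfl hne
      · exact hfar g' hgP'
      · rw [hdist_comm]; exact hfar g hgP
      · exact hP g hgP g' hgP' hne
  have := Nat.le_findGreatest (hpb _ hp) hp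
  omega

lemma IsMaxPacking.card_le_coverNumber [IsFiniteMeasure D] {η : ℝ} {P : Finset (X → Bool)}
    (hP : IsMaxPacking D H (2 * η) P) (hcov : ∃ F, IsCover D H η F) :
    P.card ≤ coverNumber D H η := by
  obtain ⟨F₀, hF₀⟩ := hcov
  obtain ⟨F, hF, hcard⟩ := Nat.sInf_mem (s := {n | ∃ F, IsCover D H η F ∧ F.card = n})
    ⟨_, F₀, hF₀, rfl⟩
  exact (card_le_card_of_packing_of_cover hP.1 hP.2.1 hF).trans hcard.le

lemma IsMaxPacking.exists_near [IsFiniteMeasure D] {a : ℝ} (ha : 0 ≤ a) {P : Finset (X → Bool)}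
    (hP : IsMaxPacking D H a P) {h : X → Bool} (hh : h ∈ H) : ∃ g ∈ P, hdist D h g ≤ a := by
  by_cases hhP : h ∈ P
  · exact ⟨h, hhP, by simpa [hdist] using ha⟩
  · exact hP.2.2 h hh hhP

/-- `H` may be infinite, but balls have only finitely many traces on `F`, so the maximum is
attained. -/
lemma exists_heaviest_center (hH : H.Nonempty) (F : Finset (X → Bool)) (lam : (X → Bool) → ℝ)
    (R : ℝ) : ∃ c ∈ H, ∀ μ ∈ H, ballMass D F lam μ R ≤ ballMass D F lam c R := by
  classical
  have hfin : ((fun μ => ballMass D F lam μ R) '' H).Finite := by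
    refine (F.powerset.image fun G => ∑ h ∈ G, lam h).finite_toSet.subset ?_
    rintro _ ⟨μ, -, rfl⟩
    refine Finset.mem_image.2 ⟨F.filter fun h => hdist D h μ ≤ R,
      Finset.mem_powerset.2 (Finset.filter_subset _ _), ?_⟩
    simp only [ballMass]
  obtain ⟨_, ⟨c, hc, rfl⟩, hmax⟩ := hfin.exists_maximal (hH.image _)
  refine ⟨c, hc, fun μ hμ => ?_⟩
  by_contra! hlt
  exact absurd (hmax ⟨μ, hμ, rfl⟩ hlt.le) (not_le.2 hlt)

/-- All objects that the algorithm has to choose exist. -/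
lemma nonempty_choices [IsProbabilityMeasure D] (hH : H.Nonempty) (hmeas : ∀ h ∈ H, Measurable h)
    {η : ℝ} (hcov : ∃ F, IsCover D H η F) (R : ℝ) {a : ℝ} (ha : 0 ≤ a) (T : ℝ) :
    Nonempty (Choices D H η R a T) := by
  classical
  obtain ⟨F, hF⟩ := hcov
  obtain ⟨P, hP⟩ := exists_isMaxPacking hF
  choose c hc hmax using fun w => exists_heaviest_center (D := D) hH P (posterior P w) R
  choose q hq using fun (w : (X → Bool) → ℝ) (S : Finset (X → Bool)) =>
    exists_isOptimalQuery (D := D) ha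
      (measurable_minority (fun h hh => hmeas h (hP.1 hh)) (capped (posterior P w) S))
      (finite_range_minority P (capped (posterior P w) S))
  have hpair : ∀ C : Finset (X → Bool), ∃ p : (X → Bool) × (X → Bool),
      (∃ h ∈ C, ∃ h' ∈ C, T < hdist D h h') → p.1 ∈ C ∧ p.2 ∈ C ∧ T < hdist D p.1 p.2 := by
    intro C
    by_cases h : ∃ h ∈ C, ∃ h' ∈ C, T < hdist D h h'
    · obtain ⟨h, hh, h', hh', hT⟩ := h
      exact ⟨(h, h'), fun _ => ⟨hh, hh', hT⟩⟩
    · exact ⟨(fun _ => true, fun _ => true), fun h' => absurd h' h⟩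
  have hpick : ∀ C : Finset (X → Bool), ∃ h : X → Bool, C.Nonempty → h ∈ C := by
    intro C
    by_cases h : C.Nonempty
    · exact ⟨h.choose, fun _ => h.choose_spec⟩
    · exact ⟨fun _ => true, fun h' => absurd h' h⟩
  choose pr hpr using hpair
  choose pk hpk using hpick
  exact ⟨⟨P, hP, c, hc, hmax, q, fun w S _ => hq w S, pr, hpr, pk, hpk⟩⟩

end ActiveLearning

namespace ActiveLearning

variable {X : Type*} [MeasurableSpace X] {D : Measure X} {H : Set (X → Bool)}

/-! ### Success probabilities of learners -/

/-- Failure bounds such as the potential may exceed `1`, so `f` can be negative and is truncated at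
`0`; truncation only helps. -/
lemma ofReal_integral_le_lintegral {q : Measure X} {f : X → ℝ} (hf : Integrable f q) :
    ENNReal.ofReal (∫ x, f x ∂q) ≤ ∫⁻ x, ENNReal.ofReal (f x) ∂q := by
  have h : ∫ x, f x ∂q ≤ ∫ x, max (f x) 0 ∂q :=
    integral_mono hf hf.pos_part fun x => le_max_left _ _
  refine (ENNReal.ofReal_le_ofReal h).trans ?_
  rw [ofReal_integral_eq_lintegral_ofReal hf.pos_part
    (Filter.Eventually.of_forall fun x => le_max_right _ _)]
  refine lintegral_mono fun x => ?_
  simp [ENNReal.ofReal_max]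

lemma ofReal_le_lintegral_label (κ : Kernel X Bool) [IsMarkovKernel κ] (h : X → Bool) (x : X)
    {f : Bool → ENNReal} {g : Bool → ℝ} (hfg : ∀ y, ENNReal.ofReal (g y) ≤ f y) :
    ENNReal.ofReal ((1 - noise κ h x) * g (h x) + noise κ h x * g (!h x)) ≤
      ∫⁻ y, f y ∂(κ x) := by
  have hn : noise κ h x = (κ x).real {!h x} := by
    rw [noise]; congr 1; ext y; cases h x <;> cases y <;> simp
  have hn' : 1 - noise κ h x = (κ x).real {h x} := by
    rw [hn, ← probReal_compl_eq_one_sub (measurableSet_singleton _)]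
    congr 1; ext y; cases h x <;> cases y <;> simp
  have hs : ∫⁻ y, f y ∂(κ x) = f (h x) * κ x {h x} + f (!h x) * κ x {!h x} := by
    rw [lintegral_fintype, Fintype.sum_bool]
    cases h x
    · exact add_comm _ _
    · rfl
  rw [hn', hn, hs]
  refine ENNReal.ofReal_add_le.trans (add_le_add ?_ ?_) <;>
  · rw [ENNReal.ofReal_mul measureReal_nonneg, mul_comm, ofReal_measureReal]
    exact mul_le_mul_left (hfg _) _

lemma integral_add_const_mul {q : Measure X} [IsProbabilityMeasure q] {f : X → ℝ}
    (hf : Integrable f q) (a b : ℝ) : ∫ x, (a + b * f x) ∂q = a + b * ∫ x, f x ∂q := by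
  rw [integral_add (integrable_const _) (hf.const_mul _), integral_const, integral_const_mul]
  simp

/-- One query: if the learner fails with probability at most `g x y` after seeing `(x, y)`, then it
fails with probability at most the mean of `g`. -/
lemma ofReal_le_prob_query (κ : Kernel X Bool) [IsMarkovKernel κ] {E : (X → Bool) → ℕ → Prop}
    {q : Measure X} [IsProbabilityMeasure q] {next : X → Bool → Learner X} {n : ℕ}
    (h : X → Bool) {g : X → Bool → ℝ} {G : X → ℝ} {b : ℝ} (hG : Integrable G q)
    (hnext : ∀ x y, ENNReal.ofReal (1 - g x y) ≤ (next x y).prob κ E (n + 1))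
    (hgG : ∀ x, (1 - noise κ h x) * g x (h x) + noise κ h x * g x (!h x) ≤ G x)
    (hb : ∫ x, G x ∂q ≤ b) :
    ENNReal.ofReal (1 - b) ≤ (Learner.query q next).prob κ E n := by
  have h1 : 1 - b ≤ ∫ x, (1 - G x) ∂q := by
    rw [integral_sub (integrable_const _) hG, integral_const]
    simp only [probReal_univ, smul_eq_mul, one_mul]
    linarith
  refine (ENNReal.ofReal_le_ofReal h1).trans
    ((ofReal_integral_le_lintegral ((integrable_const 1).sub hG)).trans ?_)
  rw [Learner.prob]
  -- The success probability need not be measurable in `x`: the lower integral is monotone, and the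
  -- minorant is integrable.
  refine lintegral_mono fun x => ?_
  refine le_trans (ENNReal.ofReal_le_ofReal ?_) (ofReal_le_lintegral_label κ h x (hnext x))
  have := hgG x
  simp only [Pi.sub_apply]
  linarith

/-- The exponential moment method: each sample multiplies the mean of `A ^ m` by at most `B`. Both
`A > 1` and `A < 1` are used, for too many and too few mistakes. `N` is the query count at which
`next` takes over. -/
lemma ofReal_le_prob_countMistakes (κ : Kernel X Bool) [IsMarkovKernel κ]
    {E : (X → Bool) → ℕ → Prop} {q : Measure X} [IsProbabilityMeasure q] {h : X → Bool}
    (hh : Measurable h) {next : ℕ → Learner X} {F c A B : ℝ} {N : ℕ} (hc : 0 ≤ c) (hA : 0 ≤ A)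
    (hB0 : 0 ≤ B)
    (hB : (1 - ∫ x, noise κ h x ∂q) + (∫ x, noise κ h x ∂q) * A ≤ B)
    (hnext : ∀ m, ENNReal.ofReal (1 - (F + c * A ^ m)) ≤ (next m).prob κ E N) :
    ∀ k m n, n + k = N →
      ENNReal.ofReal (1 - (F + c * A ^ m * B ^ k)) ≤ (countMistakes q h next k m).prob κ E n := by
  intro k
  induction k with
  | zero =>
    intro m n hn
    obtain rfl : n = N := hn
    simpa [countMistakes] using hnext m
  | succ k ih =>
    intro m n hn
    rw [countMistakes]
    have hi := integrable_noise κ hh q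
    refine ofReal_le_prob_query κ h
      (g := fun x y => F + c * A ^ (if h x = y then m else m + 1) * B ^ k)
      (G := fun x => (F + c * A ^ m * B ^ k) + c * A ^ m * B ^ k * (A - 1) * noise κ h x)
      ((integrable_const _).add (hi.const_mul _))
      (fun x y => ih _ _ (by omega)) (fun x => le_of_eq ?_) ?_
    · have : (h x = !h x) = False := by cases h x <;> simp
      simp only [this, if_true, if_false]
      ring
    · rw [integral_add_const_mul hi]
      have := mul_le_mul_of_nonneg_left hB
        (mul_nonneg (mul_nonneg hc (pow_nonneg hA m)) (pow_nonneg hB0 k))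
      rw [pow_succ]
      linarith

/-! ### The second stage -/

/-- Conditioning on `A` inflates the error by at most `1 / D(A) < 1 / T`. -/
lemma integral_noise_cond_le [IsProbabilityMeasure D] (κ : Kernel X Bool) [IsMarkovKernel κ]
    {h : X → Bool} (hh : Measurable h) {A : Set X} {t T : ℝ} (hT : 0 ≤ T)
    (ht : 0 ≤ t) (herr : err D κ h ≤ t * T) (hA : T < D.real A) :
    ∫ x, noise κ h x ∂(ProbabilityTheory.cond D A) ≤ t := by
  have hA0 : 0 < D.real A := hT.trans_lt hA
  rw [integral_cond, inv_mul_le_iff₀ hA0]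
  have h1 : ∫ x in A, noise κ h x ∂D ≤ ∫ x, noise κ h x ∂D :=
    setIntegral_le_integral (integrable_noise κ hh D)
      (Filter.Eventually.of_forall (noise_nonneg κ h))
  rw [← err_eq_integral_noise (D := D) κ hh] at h1
  nlinarith

lemma noise_add_noise (κ : Kernel X Bool) [IsMarkovKernel κ] {h g : X → Bool} {x : X}
    (hx : h x ≠ g x) : noise κ h x + noise κ g x = 1 := by
  have h1 : {y | g x ≠ y} = {y | h x ≠ y}ᶜ := by
    ext y; revert hx; cases h x <;> cases g x <;> cases y <;> simp
  rw [noise, noise, h1, measureReal_add_measureReal_compl (Set.toFinite _).measurableSet,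
    probReal_univ]

lemma integral_noise_cond_ne [IsProbabilityMeasure D] (κ : Kernel X Bool) [IsMarkovKernel κ]
    {h g : X → Bool} (hh : Measurable h) (hg : Measurable g)
    (h0 : 0 < hdist D h g) :
    ∫ x, noise κ h x ∂(ProbabilityTheory.cond D {x | h x ≠ g x}) =
      1 - ∫ x, noise κ g x ∂(ProbabilityTheory.cond D {x | h x ≠ g x}) := by
  have hp : IsProbabilityMeasure (ProbabilityTheory.cond D {x | h x ≠ g x}) :=
    cond_isProbabilityMeasure fun h' => by simp [hdist, measureReal_def, h'] at h0
  have : ∫ x, (noise κ h x + noise κ g x) ∂(ProbabilityTheory.cond D {x | h x ≠ g x}) =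
      ∫ x, (1 : ℝ) ∂(ProbabilityTheory.cond D {x | h x ≠ g x}) := by
    refine integral_congr_ae ?_
    filter_upwards [ae_cond_mem (μ := D) (measurableSet_ne hh hg)] with x hx
    exact noise_add_noise κ hx
  rw [integral_add (integrable_noise κ hh _) (integrable_noise κ hg _), integral_const] at this
  simp only [probReal_univ, smul_eq_mul, one_mul] at this
  linarith

/-- An equality at `P = 1/2 - g`. With base `(1 + 2g)²` per mistake, the event of at least `n/2`
mistakes in `n` samples is worth `(1 + 2g)^n`; dividing by it leaves `1 - 2g²` per sample. -/
lemma chernoff_step {g P : ℝ} (hg : 0 < g) (hP : P ≤ 1 / 2 - g) :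
    (1 - P) + P * (1 + 2 * g) ^ 2 ≤ (1 + 2 * g) * (1 - 2 * g ^ 2) := by
  nlinarith [mul_le_mul_of_nonneg_right hP (show 0 ≤ (1 + 2 * g) ^ 2 - 1 by nlinarith)]

/-- The second stage on the candidates `C` keeps the candidate `c`, whose error is well below `T`,
and hence returns a candidate within `T` of `c`. -/
lemma ofReal_le_prob_stageTwo [IsProbabilityMeasure D] (hmeas : ∀ h ∈ H, Measurable h)
    {η R a T : ℝ} (ch : Choices D H η R a T) (κ : Kernel X Bool) [IsMarkovKernel κ] (hT : 0 ≤ T)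
    {g : ℝ} (hg : 0 < g) (hg2 : g < 1 / 2) {c : X → Bool} (hcerr : err D κ c ≤ (1 / 2 - g) * T)
    {B M : ℝ} (hB : err D κ c + T ≤ B) (n : ℕ) :
    ∀ (j : ℕ) (C : Finset (X → Bool)) (k : ℕ), (↑C : Set (X → Bool)) ⊆ H → c ∈ C → C.card ≤ j →
      ((k + j * n : ℕ) : ℝ) ≤ M →
      ENNReal.ofReal (1 - j * (1 - 2 * g ^ 2) ^ n) ≤
        (stageTwo ch n j C).prob κ (fun h n => (n : ℝ) ≤ M ∧ h ∈ H ∧ err D κ h ≤ B) k := by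
  classical
  intro j
  induction j with
  | zero =>
    intro C k _ hc hcard _
    have := Finset.card_pos.2 ⟨c, hc⟩
    omega
  | succ j ih =>
    intro C k hCH hc hcard hM
    have hρ : 0 ≤ (1 - 2 * g ^ 2) ^ n := pow_nonneg (by nlinarith) n
    rw [stageTwo]
    split_ifs with hfar
    · obtain ⟨hp1, hp2, hpT⟩ := ch.pair_spec C hfar
      generalize (ch.pair C).1 = h₁ at *
      generalize (ch.pair C).2 = h₂ at *
      have hm1 := hmeas h₁ (hCH hp1)
      have hm2 := hmeas h₂ (hCH hp2)
      have hd0 : 0 < hdist D h₁ h₂ := hT.trans_lt hpT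
      have hne : h₁ ≠ h₂ := by
        rintro rfl
        simp [hdist] at hd0
      have hq : IsProbabilityMeasure (ProbabilityTheory.cond D {x | h₁ x ≠ h₂ x}) :=
        cond_isProbabilityMeasure fun h' => by simp [hdist, measureReal_def, h'] at hd0
      have hkeep : ∀ h ∈ C, c ≠ h → ENNReal.ofReal (1 - j * (1 - 2 * g ^ 2) ^ n) ≤
          (stageTwo ch n j (C.erase h)).prob κ
            (fun h n => (n : ℝ) ≤ M ∧ h ∈ H ∧ err D κ h ≤ B) (k + n) := by
        intro h hh hch
        refine ih _ _ (fun g hg => hCH (Finset.mem_of_mem_erase hg))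
          (Finset.mem_erase.2 ⟨hch, hc⟩) ?_ ?_
        · rw [Finset.card_erase_of_mem hh]; omega
        · convert hM using 2; ring
      -- Markov's inequality for both directions at once: `c' * A ^ m` has to dominate the indicator
      -- of the event that `c` is removed after `m` mistakes of `h₁`.
      have main : ∀ A B' c' : ℝ, 0 ≤ c' → 0 ≤ A → 0 ≤ B' →
          (1 - ∫ x, noise κ h₁ x ∂(ProbabilityTheory.cond D {x | h₁ x ≠ h₂ x})) +
            (∫ x, noise κ h₁ x ∂(ProbabilityTheory.cond D {x | h₁ x ≠ h₂ x})) * A ≤ B' →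
          (∀ m, c = (if n ≤ 2 * m then h₁ else h₂) → 1 ≤ c' * A ^ m) →
          c' * B' ^ n ≤ (1 - 2 * g ^ 2) ^ n →
          ENNReal.ofReal (1 - (j + 1 : ℕ) * (1 - 2 * g ^ 2) ^ n) ≤
            (countMistakes (ProbabilityTheory.cond D {x | h₁ x ≠ h₂ x}) h₁
              (fun m => stageTwo ch n j (C.erase (if n ≤ 2 * m then h₁ else h₂))) n 0).prob κ
              (fun h n => (n : ℝ) ≤ M ∧ h ∈ H ∧ err D κ h ≤ B) k := by
        intro A B' c' hc' hA hB' hstep hbad hfin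
        have := ofReal_le_prob_countMistakes κ
          (E := fun h n => (n : ℝ) ≤ M ∧ h ∈ H ∧ err D κ h ≤ B) hm1
          (next := fun m => stageTwo ch n j (C.erase (if n ≤ 2 * m then h₁ else h₂)))
          (F := j * (1 - 2 * g ^ 2) ^ n) (N := k + n) hc' hA hB' hstep ?_ n 0 k rfl
        · refine (ENNReal.ofReal_le_ofReal ?_).trans this
          push_cast
          simp only [pow_zero, mul_one]
          linarith
        · intro m
          have hpos := mul_nonneg hc' (pow_nonneg hA m)
          by_cases hcm : c = (if n ≤ 2 * m then h₁ else h₂)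
          · rw [ENNReal.ofReal_of_nonpos]
            · exact zero_le
            · have := hbad m hcm
              have := mul_nonneg (Nat.cast_nonneg (α := ℝ) j) hρ
              linarith
          · refine le_trans (ENNReal.ofReal_le_ofReal ?_)
              (hkeep _ (by split_ifs <;> assumption) hcm)
            linarith
      have hr1 : (1 : ℝ) ≤ 1 + 2 * g := by linarith
      have hr0 : (0 : ℝ) < 1 + 2 * g := by linarith
      have hρ0 : 0 ≤ 1 - 2 * g ^ 2 := by nlinarith
      by_cases hc1 : c = h₁
      · subst hc1
        have hP := integral_noise_cond_le κ hm1 hT (by linarith : 0 ≤ 1 / 2 - g) hcerr hpT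
        refine main ((1 + 2 * g) ^ 2) ((1 + 2 * g) * (1 - 2 * g ^ 2)) (((1 + 2 * g) ^ n)⁻¹)
          (by positivity) (by positivity) (by positivity) (chernoff_step hg hP) ?_ ?_
        · intro m hm
          have hnm : n ≤ 2 * m := by
            by_contra hnm
            rw [if_neg hnm] at hm
            exact hne hm
          rw [← pow_mul, ← div_eq_inv_mul, one_le_div (by positivity)]
          exact pow_le_pow_right₀ hr1 hnm
        · rw [mul_pow, inv_mul_cancel_left₀ (by positivity)]
      · by_cases hc2 : c = h₂
        · subst hc2
          have hP := integral_noise_cond_le κ hm2 hT (by linarith : 0 ≤ 1 / 2 - g) hcerr hpT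
          have hstep := chernoff_step hg hP
          refine main (((1 + 2 * g) ^ 2)⁻¹) ((1 - 2 * g ^ 2) / (1 + 2 * g)) ((1 + 2 * g) ^ n)
            (by positivity) (by positivity) (by positivity) ?_ ?_ ?_
          · rw [integral_noise_cond_ne κ hm1 hm2 hd0]
            generalize ∫ x, noise κ c x ∂_ = P at *
            have e : (1 - (1 - P)) + (1 - P) * ((1 + 2 * g) ^ 2)⁻¹ =
                ((1 - P) + P * (1 + 2 * g) ^ 2) / (1 + 2 * g) ^ 2 := by
              field_simp; ring
            rw [e, div_le_div_iff₀ (by positivity) hr0]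
            nlinarith
          · intro m hm
            have hnm : ¬ n ≤ 2 * m := by
              intro hnm
              rw [if_pos hnm] at hm
              exact hc1 hm
            rw [inv_pow, ← pow_mul, ← div_eq_mul_inv, one_le_div (by positivity)]
            exact pow_le_pow_right₀ hr1 (by omega)
          · rw [div_pow, mul_div_cancel₀ _ (by positivity)]
        · refine main 1 1 0 le_rfl zero_le_one zero_le_one (by linarith) ?_ (by simpa using hρ)
          intro m hm
          split_ifs at hm
          · exact absurd hm hc1
          · exact absurd hm hc2
    · have hpk := ch.pick_mem C ⟨c, hc⟩
      push Not at hfar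
      rw [Learner.prob, if_pos]
      · refine ENNReal.ofReal_le_one.2 ?_
        have := mul_nonneg (Nat.cast_nonneg (α := ℝ) (j + 1)) hρ
        linarith
      · refine ⟨(Nat.cast_le.2 (Nat.le_add_right _ _)).trans hM, hCH hpk, ?_⟩
        have h1 := err_le_err_add_hdist (D := D) κ (hmeas _ (hCH hpk)) (hmeas _ (hCH hc))
        have h2 := hfar c hc _ hpk
        linarith

end ActiveLearning

namespace ActiveLearning

/-! ### Capped distributions, the potential and its change under updates -/

section Weights

variable {X : Type*} {F S G : Finset (X → Bool)} {w : (X → Bool) → ℝ} {t : X → Bool}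

open Classical in
/-- The total weight of the hypotheses in `G` that are not capped. -/
noncomputable def freeWeight (w : (X → Bool) → ℝ) (S G : Finset (X → Bool)) : ℝ :=
  ∑ h ∈ G with h ∉ S, w h

/-- The potential `1 / (λ(t) · λ(t | Sᶜ))` of the hypothesis `t`, where `λ` is the distribution on
`F` with weights `w`. -/
noncomputable def potential (F : Finset (X → Bool)) (w : (X → Bool) → ℝ) (S : Finset (X → Bool))
    (t : X → Bool) : ℝ :=
  (∑ h ∈ F, w h) * freeWeight w S F / w t ^ 2

lemma sum_le_sum_of_subset_of_pos (hw : ∀ h ∈ F, 0 < w h) (hG : G ⊆ F) :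
    ∑ h ∈ G, w h ≤ ∑ h ∈ F, w h :=
  Finset.sum_le_sum_of_subset_of_nonneg hG fun h hh _ => (hw h hh).le

lemma freeWeight_mono (hw : ∀ h ∈ F, 0 < w h) (hG : G ⊆ F) :
    freeWeight w S G ≤ freeWeight w S F := by
  classical
  exact Finset.sum_le_sum_of_subset_of_nonneg (Finset.filter_subset_filter _ hG)
    fun h hh _ => (hw h (Finset.mem_filter.1 hh).1).le

lemma le_sum_weights (hw : ∀ h ∈ F, 0 < w h) (ht : t ∈ F) : w t ≤ ∑ h ∈ F, w h :=
  Finset.single_le_sum (fun h hh => (hw h hh).le) ht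

lemma le_freeWeight (hw : ∀ h ∈ F, 0 < w h) (ht : t ∈ F) (htS : t ∉ S) :
    w t ≤ freeWeight w S F := by
  classical
  exact Finset.single_le_sum (f := w)
    (fun h hh => (hw h (Finset.mem_filter.1 hh).1).le) (Finset.mem_filter.2 ⟨ht, htS⟩)

lemma one_le_potential (hw : ∀ h ∈ F, 0 < w h) (ht : t ∈ F) (htS : t ∉ S) :
    1 ≤ potential F w S t := by
  have h0 := hw t ht
  rw [potential, one_le_div (by positivity), sq]
  exact mul_le_mul (le_sum_weights hw ht) (le_freeWeight hw ht htS) h0.le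
    (h0.le.trans (le_sum_weights hw ht))

/-- Capping averages the distribution with its restriction to the complement of `S`. -/
lemma sum_capped (hw : ∀ h ∈ F, 0 < w h) (ht : t ∈ F) (htS : t ∉ S) (hS : S ⊆ F)
    (G : Finset (X → Bool)) :
    ∑ h ∈ G, capped (posterior F w) S h =
      1 / 2 * ((∑ h ∈ G, w h) / ∑ h ∈ F, w h) + 1 / 2 * (freeWeight w S G / freeWeight w S F) := by
  classical
  have hW : 0 < ∑ h ∈ F, w h := (hw t ht).trans_le (le_sum_weights hw ht)
  have hV : 0 < freeWeight w S F := (hw t ht).trans_le (le_freeWeight hw ht htS)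
  have hsplit : ∑ h ∈ S, w h + freeWeight w S F = ∑ h ∈ F, w h := by
    rw [freeWeight, ← Finset.sum_filter_add_sum_filter_not F (fun h => h ∈ S) w,
      Finset.filter_mem_eq_inter, Finset.inter_eq_right.2 hS]
  have hSsum : ∑ h ∈ S, posterior F w h = 1 - freeWeight w S F / ∑ h ∈ F, w h := by
    simp only [posterior]
    rw [← Finset.sum_div, ← hsplit]
    rw [← hsplit] at hW
    field_simp
    ring
  have hcap : ∀ h, capped (posterior F w) S h =
      1 / 2 * (w h / ∑ h ∈ F, w h) +
        1 / 2 * ((if h ∉ S then w h else 0) / freeWeight w S F) := by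
    intro h
    rw [capped, hSsum]
    by_cases hh : h ∈ S
    · simp [hh, posterior]
    · rw [sub_sub_cancel]
      simp only [hh, if_false, not_false_eq_true, if_true, posterior]
      field_simp
      ring
  have hG : freeWeight w S G = ∑ h ∈ G, if h ∉ S then w h else 0 := Finset.sum_filter _ _
  simp only [hcap]
  rw [hG, Finset.sum_add_distrib, ← Finset.mul_sum, ← Finset.mul_sum, ← Finset.sum_div,
    ← Finset.sum_div]

lemma isDistribution_capped (hw : ∀ h ∈ F, 0 < w h) (ht : t ∈ F)
    (htS : t ∉ S) (hS : S ⊆ F) : IsDistribution F (capped (posterior F w) S) := by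
  classical
  have hW : 0 < ∑ h ∈ F, w h := (hw t ht).trans_le (le_sum_weights hw ht)
  have hV : 0 < freeWeight w S F := (hw t ht).trans_le (le_freeWeight hw ht htS)
  constructor
  · intro h hh
    have h1 := sum_capped hw ht htS hS {h}
    rw [Finset.sum_singleton, Finset.sum_singleton] at h1
    rw [h1]
    have h2 : 0 ≤ freeWeight w S {h} := Finset.sum_nonneg fun g hg => by
      rw [Finset.mem_singleton.1 (Finset.mem_filter.1 hg).1]
      exact (hw h hh).le
    have := hw h hh
    positivity
  · rw [sum_capped hw ht htS hS, div_self hW.ne', div_self hV.ne']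
    norm_num

/-- A set with more than `80%` of the capped distribution has more than `60%` of the distribution
itself and of its restriction to the complement of `S`. -/
lemma weight_of_heavy (hw : ∀ h ∈ F, 0 < w h) (ht : t ∈ F) (htS : t ∉ S) (hS : S ⊆ F)
    (hG : G ⊆ F) (hheavy : 4 / 5 < ∑ h ∈ G, capped (posterior F w) S h) :
    3 / 5 * ∑ h ∈ F, w h < ∑ h ∈ G, w h ∧ 3 / 5 * freeWeight w S F < freeWeight w S G := by
  have hW : 0 < ∑ h ∈ F, w h := (hw t ht).trans_le (le_sum_weights hw ht)
  have hV : 0 < freeWeight w S F := (hw t ht).trans_le (le_freeWeight hw ht htS)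
  rw [sum_capped hw ht htS hS] at hheavy
  have h1 : (∑ h ∈ G, w h) / ∑ h ∈ F, w h ≤ 1 :=
    (div_le_one hW).2 (sum_le_sum_of_subset_of_pos hw hG)
  have h2 : freeWeight w S G / freeWeight w S F ≤ 1 :=
    (div_le_one hV).2 (freeWeight_mono hw hG)
  exact ⟨(lt_div_iff₀ hW).1 (by linarith), (lt_div_iff₀ hV).1 (by linarith)⟩

lemma exists_mem_inter_of_heavy {G' : Finset (X → Bool)} (hw : ∀ h ∈ F, 0 < w h)
    (hG : G ⊆ F) (hG' : G' ⊆ F) (h1 : 3 / 5 * ∑ h ∈ F, w h < ∑ h ∈ G, w h)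
    (h2 : 3 / 5 * ∑ h ∈ F, w h < ∑ h ∈ G', w h) : ∃ h ∈ G, h ∈ G' := by
  classical
  by_contra! hdis
  have hd : Disjoint G G' := Finset.disjoint_left.2 hdis
  have h3 := sum_le_sum_of_subset_of_pos hw (Finset.union_subset hG hG')
  rw [Finset.sum_union hd] at h3
  have h4 : 0 ≤ ∑ h ∈ F, w h := Finset.sum_nonneg fun h hh => (hw h hh).le
  linarith

/-- The heavy set holds more than 60% of the free weight and loses all of it to `S'`; the total
weight and `w t` do not change. -/
lemma potential_le_of_heavy {S' : Finset (X → Bool)} (hw : ∀ h ∈ F, 0 < w h) (ht : t ∈ F)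
    (htS : t ∉ S) (hS : S ⊆ F) (hG : G ⊆ F)
    (hheavy : 4 / 5 < ∑ h ∈ G, capped (posterior F w) S h) (hSS' : S ⊆ S') (hGS' : G ⊆ S') :
    potential F w S' t ≤ 2 / 5 * potential F w S t := by
  classical
  have hW : 0 < ∑ h ∈ F, w h := (hw t ht).trans_le (le_sum_weights hw ht)
  obtain ⟨-, h2⟩ := weight_of_heavy hw ht htS hS hG hheavy
  have h3 : freeWeight w S' F + freeWeight w S G ≤ freeWeight w S F := by
    rw [freeWeight, freeWeight, ← Finset.sum_union]
    · refine Finset.sum_le_sum_of_subset_of_nonneg ?_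
        fun h hh _ => (hw h (Finset.mem_filter.1 hh).1).le
      intro h hh
      rcases Finset.mem_union.1 hh with hh | hh <;> obtain ⟨ha, hb⟩ := Finset.mem_filter.1 hh
      · exact Finset.mem_filter.2 ⟨ha, fun hc => hb (hSS' hc)⟩
      · exact Finset.mem_filter.2 ⟨hG ha, hb⟩
    · refine Finset.disjoint_left.2 fun h hh hh' => ?_
      exact (Finset.mem_filter.1 hh).2 (hGS' (Finset.mem_filter.1 hh').1)
  rw [potential, potential, ← mul_div_assoc]
  refine div_le_div_of_nonneg_right ?_ (sq_nonneg _)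
  nlinarith

lemma nextW_pos {α : ℝ} (hw : ∀ h ∈ F, 0 < w h) (x : X) (y : Bool) :
    ∀ h ∈ F, 0 < nextW F α w x y h := by
  intro h hh
  have := hw h hh
  rw [nextW]
  split_ifs <;> positivity

lemma sum_nextW {α : ℝ} (hα : Real.exp (-α) = 9 / 10) (hG : G ⊆ F) (x : X) (y : Bool) :
    ∑ h ∈ G, nextW F α w x y h = ∑ h ∈ G, w h - 1 / 10 * ∑ h ∈ G with h x ≠ y, w h := by
  rw [Finset.sum_filter, Finset.mul_sum, ← Finset.sum_sub_distrib]
  refine Finset.sum_congr rfl fun h hh => ?_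
  rw [nextW, hα]
  by_cases hy : h x = y
  · simp [hy]
  · simp only [hG hh, ne_eq, hy, not_false_eq_true, and_self, if_true]
    ring

lemma freeWeight_nextW {α : ℝ} (hα : Real.exp (-α) = 9 / 10) (x : X) (y : Bool) :
    freeWeight (nextW F α w x y) S F =
      freeWeight w S F - 1 / 10 * freeWeight w S (F.filter fun h => h x ≠ y) := by
  classical
  rw [freeWeight, sum_nextW hα (Finset.filter_subset _ _), Finset.filter_comm]
  rfl

/-- The mass under the capped distribution of the hypotheses that disagree with `t` at `x`. -/
noncomputable def disagreement (F : Finset (X → Bool)) (w : (X → Bool) → ℝ)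
    (S : Finset (X → Bool)) (t : X → Bool) (x : X) : ℝ :=
  ∑ h ∈ F with h x ≠ t x, capped (posterior F w) S h

lemma sum_filter_not_agree (f : (X → Bool) → ℝ) (G : Finset (X → Bool)) (t : X → Bool) (x : X) :
    ∑ h ∈ G with h x ≠ !t x, f h = ∑ h ∈ G, f h - ∑ h ∈ G with h x ≠ t x, f h := by
  rw [eq_sub_iff_add_eq, ← Finset.sum_filter_add_sum_filter_not G (fun h => h x ≠ !t x) f]
  congr 2
  ext h
  simp only [Finset.mem_filter]
  cases h x <;> cases t x <;> simp

lemma disagreement_nonneg (hw : ∀ h ∈ F, 0 < w h) (ht : t ∈ F)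
    (htS : t ∉ S) (hS : S ⊆ F) (x : X) : 0 ≤ disagreement F w S t x := by
  exact Finset.sum_nonneg fun h hh =>
    (isDistribution_capped hw ht htS hS).1 h (Finset.mem_filter.1 hh).1

lemma disagreement_le_one (hw : ∀ h ∈ F, 0 < w h) (ht : t ∈ F)
    (htS : t ∉ S) (hS : S ⊆ F) (x : X) : disagreement F w S t x ≤ 1 := by
  have hd := isDistribution_capped hw ht htS hS
  rw [← hd.2]
  exact Finset.sum_le_sum_of_subset_of_nonneg (Finset.filter_subset _ _) fun h hh _ => hd.1 h hh

/-- The hypotheses that disagree with `t` at `x` form one of the two label classes, and the minority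
is the lighter of these. -/
lemma minority_le_disagreement (hw : ∀ h ∈ F, 0 < w h) (ht : t ∈ F)
    (htS : t ∉ S) (hS : S ⊆ F) (x : X) :
    minority F (capped (posterior F w) S) x ≤ disagreement F w S t x := by
  have hd := isDistribution_capped hw ht htS hS
  have h1 := Finset.sum_filter_add_sum_filter_not F (fun h => h x = true)
    (capped (posterior F w) S)
  rw [hd.2] at h1
  rw [minority, disagreement]
  cases htx : t x
  · refine (min_le_left _ _).trans (le_of_eq ?_)
    simp
  · refine (min_le_right _ _).trans (le_of_eq ?_)
    simp only [ne_eq]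
    linarith

/-- Let `u` and `v` be the fractions of the total and of the free weight that disagree with `t` at
`x`. If the label agrees with `t`, these two weights shrink by `1 - u/10` and `1 - v/10`. Otherwise
they grow relative to `w t` by `(1 - (1 - u)/10) / (9/10) = 1 + u/9` and likewise `1 + v/9`. The
AM-GM inequality replaces `u` and `v` by their mean, which is the disagreement under the capped
distribution. -/
lemma potential_nextW_le (hw : ∀ h ∈ F, 0 < w h) (ht : t ∈ F) (htS : t ∉ S) (hS : S ⊆ F) {α : ℝ}
    (hα : Real.exp (-α) = 9 / 10) (x : X) :
    potential F (nextW F α w x (t x)) S t ≤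
        potential F w S t * (1 - disagreement F w S t x / 10) ^ 2 ∧
      potential F (nextW F α w x (!t x)) S t ≤
        potential F w S t * (1 + disagreement F w S t x / 9) ^ 2 := by
  classical
  have h0 := hw t ht
  have hW : 0 < ∑ h ∈ F, w h := h0.trans_le (le_sum_weights hw ht)
  have hV : 0 < freeWeight w S F := h0.trans_le (le_freeWeight hw ht htS)
  have hpos : 0 ≤ potential F w S t := zero_le_one.trans (one_le_potential hw ht htS)
  have hs := sum_capped hw ht htS hS (F.filter fun h => h x ≠ t x)
  set u := (∑ h ∈ F with h x ≠ t x, w h) / ∑ h ∈ F, w h with hu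
  set v := freeWeight w S (F.filter fun h => h x ≠ t x) / freeWeight w S F with hv
  have hd : disagreement F w S t x = (u + v) / 2 := by rw [disagreement, hs]; ring
  have huW : ∑ h ∈ F with h x ≠ t x, w h = u * ∑ h ∈ F, w h := by rw [hu]; field_simp
  have hvV : freeWeight w S (F.filter fun h => h x ≠ t x) = v * freeWeight w S F := by
    rw [hv]; field_simp
  have hvV' : freeWeight w S (F.filter fun h => h x ≠ !t x) = (1 - v) * freeWeight w S F := by
    have := sum_filter_not_agree w (F.filter fun h => h ∉ S) t x
    rw [Finset.filter_comm, Finset.filter_comm (fun h => h ∉ S)] at this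
    have e : freeWeight w S (F.filter fun h => h x ≠ !t x) =
      freeWeight w S F - freeWeight w S (F.filter fun h => h x ≠ t x) := this
    rw [e, hvV]; ring
  constructor
  · have e1 : nextW F α w x (t x) t = w t := by simp [nextW]
    have e : potential F (nextW F α w x (t x)) S t =
        potential F w S t * ((1 - u / 10) * (1 - v / 10)) := by
      rw [potential, potential, sum_nextW hα subset_rfl, freeWeight_nextW hα, e1, huW, hvV]
      ring
    rw [e, hd]
    exact mul_le_mul_of_nonneg_left (by nlinarith [sq_nonneg (u - v)]) hpos
  · have e1 : nextW F α w x (!t x) t = 9 / 10 * w t := by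
      rw [nextW, hα, if_pos ⟨ht, by cases t x <;> simp⟩]
    have e : potential F (nextW F α w x (!t x)) S t =
        potential F w S t * ((1 + u / 9) * (1 + v / 9)) := by
      rw [potential, potential, sum_nextW hα subset_rfl, freeWeight_nextW hα, e1,
        sum_filter_not_agree, huW, hvV']
      field_simp
      ring
    rw [e, hd]
    exact mul_le_mul_of_nonneg_left (by nlinarith [sq_nonneg (u - v)]) hpos

/-- `19/100` is `2/10` less the square term `1/100`, and `43/100` bounds `(10/9)² - (9/10)²`, the
gap at `s = 1`. -/
lemma mean_update_le {s ρ : ℝ} (hs0 : 0 ≤ s) (hs1 : s ≤ 1) (hρ0 : 0 ≤ ρ) :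
    (1 - ρ) * (1 - s / 10) ^ 2 + ρ * (1 + s / 9) ^ 2 ≤ 1 - 19 / 100 * s + 43 / 100 * ρ := by
  have h1 : (1 - s / 10) ^ 2 ≤ 1 - 19 / 100 * s := by nlinarith
  have h2 : (1 + s / 9) ^ 2 - (1 - s / 10) ^ 2 ≤ 43 / 100 := by nlinarith
  nlinarith [mul_le_mul_of_nonneg_left h2 hρ0]

end Weights

end ActiveLearning

namespace ActiveLearning

variable {X : Type*} [MeasurableSpace X] {D : Measure X} {H : Set (X → Bool)} {η R a T : ℝ}
  {w : (X → Bool) → ℝ} {S C : Finset (X → Bool)} {t : X → Bool}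

/-! ### One round of the first stage -/

lemma measurable_disagreement {F : Finset (X → Bool)} (hF : ∀ h ∈ F, Measurable h)
    (ht : t ∈ F) : Measurable (disagreement F w S t) := by
  unfold disagreement
  simp only [Finset.sum_filter]
  exact Finset.measurable_sum _ fun h hh =>
    Measurable.ite (measurableSet_ne (hF h hh) (hF t ht)) measurable_const measurable_const

lemma integrable_disagreement {F : Finset (X → Bool)} (hF : ∀ h ∈ F, Measurable h)
    (hw : ∀ h ∈ F, 0 < w h) (ht : t ∈ F) (htS : t ∉ S) (hS : S ⊆ F) (q : Measure X)
    [IsFiniteMeasure q] : Integrable (disagreement F w S t) q :=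
  Integrable.of_bound (measurable_disagreement hF ht).aestronglyMeasurable 1
    (Filter.Eventually.of_forall fun x => by
      rw [Real.norm_eq_abs, abs_of_nonneg (disagreement_nonneg hw ht htS hS x)]
      exact disagreement_le_one hw ht htS hS x)

lemma integral_minority_le {F : Finset (X → Bool)} (hF : ∀ h ∈ F, Measurable h)
    (hw : ∀ h ∈ F, 0 < w h) (ht : t ∈ F) (htS : t ∉ S) (hS : S ⊆ F) (q : Measure X)
    [IsFiniteMeasure q] :
    ∫ x, minority F (capped (posterior F w) S) x ∂q ≤ ∫ x, disagreement F w S t x ∂q := by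
  refine integral_mono_of_nonneg (Filter.Eventually.of_forall fun x => ?_)
    (integrable_disagreement hF hw ht htS hS q)
    (Filter.Eventually.of_forall (minority_le_disagreement hw ht htS hS))
  have hd := isDistribution_capped hw ht htS hS
  refine le_min (Finset.sum_nonneg fun h hh => hd.1 h (Finset.mem_filter.1 hh).1) ?_
  refine sub_nonneg.2 ?_
  rw [← hd.2]
  exact Finset.sum_le_sum_of_subset_of_nonneg (Finset.filter_subset _ _) fun h hh _ => hd.1 h hh

lemma subset_nextS (ch : Choices D H η R a T) (w : (X → Bool) → ℝ) (S : Finset (X → Bool)) :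
    S ⊆ nextS ch w S := by
  classical
  rw [nextS]
  split_ifs
  · exact Finset.subset_union_left
  · exact subset_rfl

lemma nextS_subset (ch : Choices D H η R a T) (w : (X → Bool) → ℝ) (hS : S ⊆ ch.packing) :
    nextS ch w S ⊆ ch.packing := by
  classical
  rw [nextS]
  split_ifs
  · exact Finset.union_subset hS (Finset.filter_subset _ _)
  · exact hS

lemma nextC_subset (ch : Choices D H η R a T) (cap : ℕ) (w : (X → Bool) → ℝ)
    (S : Finset (X → Bool)) (hC : (↑C : Set (X → Bool)) ⊆ H) :
    (↑(nextC ch cap w S C) : Set (X → Bool)) ⊆ H := by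
  classical
  rw [nextC]
  split_ifs
  · rw [Finset.coe_insert]
    exact Set.insert_subset (ch.center_mem w) hC
  · exact hC

lemma subset_nextC (ch : Choices D H η R a T) (cap : ℕ) (w : (X → Bool) → ℝ)
    (S C : Finset (X → Bool)) : C ⊆ nextC ch cap w S C := by
  classical
  rw [nextC]
  split_ifs
  · exact Finset.subset_insert _ _
  · exact subset_rfl

lemma card_nextC_le (ch : Choices D H η R a T) {cap : ℕ} (w : (X → Bool) → ℝ)
    (S : Finset (X → Bool)) (hC : C.card ≤ cap) : (nextC ch cap w S C).card ≤ cap := by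
  classical
  rw [nextC]
  split_ifs with h
  · exact (Finset.card_insert_le _ _).trans h.2
  · exact hC

lemma sum_posterior {X : Type*} (F G : Finset (X → Bool)) (w : (X → Bool) → ℝ) :
    ∑ h ∈ G, posterior F w h = (∑ h ∈ G, w h) / ∑ h ∈ F, w h := by
  simp only [posterior, Finset.sum_div]

open Classical in
/-- A ball with more than `60%` of the distribution lies within `3R` of the center of the heaviest
ball. -/
lemma hdist_center_le [IsFiniteMeasure D] (ch : Choices D H η R a T)
    (hw : ∀ h ∈ ch.packing, 0 < w h) {μ ν : X → Bool} (hν : ν ∈ H)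
    (hheavy : 3 / 5 * ∑ h ∈ ch.packing, w h < ∑ h ∈ ch.packing with hdist D h μ ≤ R, w h)
    (hheavy' : 3 / 5 * ∑ h ∈ ch.packing, w h < ∑ h ∈ ch.packing with hdist D h ν ≤ R, w h)
    {h : X → Bool} (hh : hdist D h μ ≤ R) : hdist D h (ch.center w) ≤ 3 * R := by
  have hmax := ch.center_heaviest w ν hν
  rw [ballMass, ballMass, sum_posterior, sum_posterior] at hmax
  have h0 : 0 ≤ ∑ h ∈ ch.packing, w h := Finset.sum_nonneg fun h hh => (hw h hh).le
  have hW : 0 < ∑ h ∈ ch.packing, w h := by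
    rcases h0.lt_or_eq with h1 | h1
    · exact h1
    · have := sum_le_sum_of_subset_of_pos hw
        (Finset.filter_subset (fun h => hdist D h μ ≤ R) ch.packing)
      linarith
  have hmax' := (div_le_div_iff_of_pos_right hW).1 hmax
  obtain ⟨g, hg, hg'⟩ := exists_mem_inter_of_heavy hw
    (Finset.filter_subset (fun h => hdist D h μ ≤ R) ch.packing)
    (Finset.filter_subset (fun h => hdist D h (ch.center w) ≤ R) ch.packing) hheavy
    (hheavy'.trans_le hmax')
  have h1 := (Finset.mem_filter.1 hg).2
  have h2 := (Finset.mem_filter.1 hg').2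
  have h3 := hdist_triangle (D := D) h μ (ch.center w)
  have h4 := hdist_triangle (D := D) μ g (ch.center w)
  rw [hdist_comm D μ g] at h4
  linarith

lemma potential_nextS_le [IsFiniteMeasure D] (ch : Choices D H η R a T)
    (hw : ∀ h ∈ ch.packing, 0 < w h) (ht : t ∈ ch.packing) (htS : t ∉ S) (hS : S ⊆ ch.packing)
    (hheavy : ∃ μ ∈ H, 4 / 5 < ballMass D ch.packing (capped (posterior ch.packing w) S) μ R) :
    potential ch.packing w (nextS ch w S) t ≤ 2 / 5 * potential ch.packing w S t := by
  classical
  obtain ⟨μ, hμ, hm⟩ := id hheavy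
  have hsub := Finset.filter_subset (fun h => hdist D h μ ≤ R) ch.packing
  have h1 := (weight_of_heavy hw ht htS hS hsub hm).1
  refine potential_le_of_heavy hw ht htS hS hsub hm (subset_nextS ch w S) ?_
  rw [nextS, if_pos hheavy]
  intro h hh
  obtain ⟨hhF, hhμ⟩ := Finset.mem_filter.1 hh
  exact Finset.mem_union_right _
    (Finset.mem_filter.2 ⟨hhF, hdist_center_le ch hw hμ h1 h1 hhμ⟩)

/-- After the test of a round no ball has more than `80%` of the capped distribution. -/
lemma ballMass_capped_nextS_le [IsFiniteMeasure D] (ch : Choices D H η R a T)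
    (hw : ∀ h ∈ ch.packing, 0 < w h) (ht : t ∈ ch.packing) (htS' : t ∉ nextS ch w S)
    (hS : S ⊆ ch.packing) {μ : X → Bool} (hμ : μ ∈ H) :
    ballMass D ch.packing (capped (posterior ch.packing w) (nextS ch w S)) μ R ≤ 4 / 5 := by
  classical
  have htS : t ∉ S := fun h => htS' (subset_nextS ch w S h)
  by_cases hheavy : ∃ μ ∈ H,
      4 / 5 < ballMass D ch.packing (capped (posterior ch.packing w) S) μ R
  · by_contra! hm
    obtain ⟨ν, hν, hm'⟩ := id hheavy
    have hsub := fun μ => Finset.filter_subset (fun h => hdist D h μ ≤ R) ch.packing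
    obtain ⟨h1, h2⟩ := weight_of_heavy hw ht htS' (nextS_subset ch w hS) (hsub μ) hm
    have h1' := (weight_of_heavy hw ht htS hS (hsub ν) hm').1
    -- The ball around `μ` has just been capped entirely, so it has no free weight, although being
    -- heavy would require more than 60% of it.
    have h3 : freeWeight w (nextS ch w S) (ch.packing.filter fun h => hdist D h μ ≤ R) = 0 := by
      rw [freeWeight]
      refine Finset.sum_eq_zero fun h hh => ?_
      obtain ⟨ha, hb⟩ := Finset.mem_filter.1 hh
      obtain ⟨hhF, hhμ⟩ := Finset.mem_filter.1 ha
      refine absurd ?_ hb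
      rw [nextS, if_pos hheavy]
      exact Finset.mem_union_right _
        (Finset.mem_filter.2 ⟨hhF, hdist_center_le ch hw hν h1 h1' hhμ⟩)
    have h4 := (hw t ht).trans_le (le_freeWeight hw ht htS')
    rw [h3] at h2
    linarith
  · have e : nextS ch w S = S := by rw [nextS, if_neg hheavy]
    rw [e]
    push Not at hheavy
    exact hheavy μ hμ

/-! ### The first stage -/

/-- Once a center near `t` is among the candidates, the rest of the first stage does not
matter. -/
lemma ofReal_le_prob_stageOne_of_near (ch : Choices D H η R a T)
    (κ : Kernel X Bool) [IsMarkovKernel κ] {E : (X → Bool) → ℕ → Prop} {α : ℝ} {cap N : ℕ}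
    {r γ : ℝ} {finish : Finset (X → Bool) → Learner X}
    (hfinish : ∀ C : Finset (X → Bool), (↑C : Set (X → Bool)) ⊆ H → C.card ≤ cap →
      (∃ c ∈ C, hdist D t c ≤ r) → ENNReal.ofReal (1 - γ) ≤ (finish C).prob κ E N) :
    ∀ (k : ℕ) (w : (X → Bool) → ℝ) (S C : Finset (X → Bool)) (n : ℕ), S ⊆ ch.packing →
      (↑C : Set (X → Bool)) ⊆ H → C.card ≤ cap → (∃ c ∈ C, hdist D t c ≤ r) → n + k = N →
      ENNReal.ofReal (1 - γ) ≤ (stageOne ch α cap finish k w S C).prob κ E n := by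
  intro k
  induction k with
  | zero =>
    rintro w S C n - hC hcard hc rfl
    exact hfinish C hC hcard hc
  | succ k ih =>
    rintro w S C n hS hC hcard ⟨c, hcC, hc⟩ hn
    have hS' := nextS_subset ch w hS
    have := (ch.queryDist_optimal w _ hS').1.1
    rw [stageOne]
    refine ofReal_le_prob_query κ t (g := fun _ _ => γ) (G := fun _ => γ) (integrable_const _)
      (fun x y => ih _ _ _ _ hS' (nextC_subset ch cap w S hC) (card_nextC_le ch w S hcard)
        ⟨c, subset_nextC ch cap w S C hcC, hc⟩ (by omega)) (fun x => le_of_eq (by ring)) ?_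
    simp

/-- The expected potential shrinks in every round in which `t` is not capped. -/
lemma integral_mean_update_le [IsProbabilityMeasure D] (hmeas : ∀ h ∈ H, Measurable h)
    {c₄ c₅ ε β : ℝ} (hη : 0 ≤ η) (hc₄ : 300 ≤ c₄) (hβ : 0 ≤ β)
    (ch : Choices D H η (c₄ * η + c₅ * ε) (c₄ / 20 * η) T)
    (hval : HasQueryValue D H c₄ c₅ η ε β) (κ : Kernel X Bool) [IsMarkovKernel κ]
    (hw : ∀ h ∈ ch.packing, 0 < w h) (ht : t ∈ ch.packing) (hterr : err D κ t ≤ 3 * η)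
    (hS : S ⊆ ch.packing) (htS' : t ∉ nextS ch w S) :
    ∫ x, (1 - 19 / 100 * disagreement ch.packing w (nextS ch w S) t x +
      43 / 100 * noise κ t x) ∂(ch.queryDist w (nextS ch w S)) ≤ Real.exp (-(β / 10)) := by
  have hS' := nextS_subset ch w hS
  have hF : ∀ h ∈ ch.packing, Measurable h := fun h hh => hmeas h (ch.packing_spec.1 hh)
  obtain ⟨hq, hopt⟩ := ch.queryDist_optimal w _ hS'
  obtain ⟨q', hq', hv⟩ := hval ch.packing _ ch.packing_spec.1
    (isDistribution_capped hw ht htS' hS')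
    (fun μ hμ => ballMass_capped_nextS_le ch hw ht htS' hS hμ)
  have hv := hv.trans (hopt q' hq')
  have := hq.1
  generalize ch.queryDist w (nextS ch w S) = q at *
  have h1 := integral_minority_le hF hw ht htS' hS' q
  have h2 := hq.integral_le (noise_nonneg κ t) (integrable_noise κ (hF t ht) D)
  rw [← err_eq_integral_noise (D := D) κ (hF t ht)] at h2
  have h3 := mul_le_mul_of_nonneg_left hterr (maxRatio_nonneg D q)
  -- Here `c₄ ≥ 300` enters: the penalty is worth at least `19/100 · 15`, while noise costs at most
  -- `43/100 · 3`, both in units of `η · maxRatio`. What remains is at most `1 - 19/100 β`.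
  have h4 : 15 * η * maxRatio D q ≤ c₄ / 20 * η * maxRatio D q :=
    mul_le_mul_of_nonneg_right (mul_le_mul_of_nonneg_right (by linarith) hη) (maxRatio_nonneg D q)
  have h5 : 0 ≤ η * maxRatio D q := mul_nonneg hη (maxRatio_nonneg D q)
  rw [queryValue] at hv
  have hi := integrable_disagreement hF hw ht htS' hS' q
  have hi' : Integrable (fun x => 1 - 19 / 100 *
      disagreement ch.packing w (nextS ch w S) t x) q := (integrable_const _).sub (hi.const_mul _)
  rw [integral_add hi' ((integrable_noise κ (hF t ht) q).const_mul _),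
    integral_sub (integrable_const _) (hi.const_mul _), integral_const_mul, integral_const_mul, integral_const]
  simp only [probReal_univ, smul_eq_mul, one_mul]
  have h6 := Real.add_one_le_exp (-(β / 10))
  linarith

/-- The first stage fails to find a center near `t` only if the potential of `t` stays high in all
rounds, or is high after `cap` centers. -/
lemma ofReal_le_prob_stageOne [IsProbabilityMeasure D] (hmeas : ∀ h ∈ H, Measurable h)
    {c₄ c₅ ε β : ℝ} (hη : 0 ≤ η) (hc₄ : 300 ≤ c₄) (hβ : 0 ≤ β)
    (ch : Choices D H η (c₄ * η + c₅ * ε) (c₄ / 20 * η) T)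
    (hval : HasQueryValue D H c₄ c₅ η ε β) (κ : Kernel X Bool) [IsMarkovKernel κ]
    (ht : t ∈ ch.packing) (hterr : err D κ t ≤ 3 * η)
    {E : (X → Bool) → ℕ → Prop} {α : ℝ} (hα : Real.exp (-α) = 9 / 10) {cap N : ℕ}
    {γ : ℝ} (hγ : 0 ≤ γ) {finish : Finset (X → Bool) → Learner X}
    (hfinish : ∀ C : Finset (X → Bool), (↑C : Set (X → Bool)) ⊆ H → C.card ≤ cap →
      (∃ c ∈ C, hdist D t c ≤ 3 * (c₄ * η + c₅ * ε)) →
      ENNReal.ofReal (1 - γ) ≤ (finish C).prob κ E N) :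
    ∀ (k : ℕ) (w : (X → Bool) → ℝ) (S C : Finset (X → Bool)) (n : ℕ),
      (∀ h ∈ ch.packing, 0 < w h) → S ⊆ ch.packing → t ∉ S →
      (↑C : Set (X → Bool)) ⊆ H → C.card ≤ cap → n + k = N →
      ENNReal.ofReal (1 - (γ + potential ch.packing w S t *
          (Real.exp (-(β / 10)) ^ k + (2 / 5) ^ (cap - C.card)))) ≤
        (stageOne ch α cap finish k w S C).prob κ E n := by
  classical
  intro k
  induction k with
  | zero =>
    intro w S C n hw hS htS hC hcard hn
    -- With no rounds left the claimed failure bound is at least `1`, because the potential is.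
    have h1 := one_le_potential hw ht htS
    have h2 : (0 : ℝ) ≤ (2 / 5) ^ (cap - C.card) := by positivity
    rw [ENNReal.ofReal_of_nonpos]
    · exact zero_le
    · rw [pow_zero]
      nlinarith
  | succ k ih =>
    intro w S C n hw hS htS hC hcard hn
    have hΦ := one_le_potential hw ht htS
    have he : (0 : ℝ) ≤ Real.exp (-(β / 10)) := (Real.exp_pos _).le
    have he1 : Real.exp (-(β / 10)) ≤ 1 := Real.exp_le_one_iff.2 (by linarith)
    -- A heavy ball is found but no place is left: the exponent of `2/5` is `0`, and the bound is
    -- again trivial.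
    by_cases hfull : (∃ μ ∈ H, 4 / 5 < ballMass D ch.packing
        (capped (posterior ch.packing w) S) μ (c₄ * η + c₅ * ε)) ∧ ¬ C.card < cap
    · rw [ENNReal.ofReal_of_nonpos]
      · exact zero_le
      · rw [Nat.sub_eq_zero_of_le (not_lt.1 hfull.2), pow_zero]
        nlinarith [pow_nonneg he (k + 1)]
    have hS' := nextS_subset ch w hS
    have hC' := nextC_subset ch cap w S hC
    have hcard' := card_nextC_le ch w S hcard
    have hq := (ch.queryDist_optimal w _ hS').1.1
    have hb0 : (0 : ℝ) ≤ (2 / 5) ^ (cap - C.card) := by positivity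
    rw [stageOne]
    by_cases htS' : t ∈ nextS ch w S
    · have hheavy : ∃ μ ∈ H, 4 / 5 < ballMass D ch.packing
          (capped (posterior ch.packing w) S) μ (c₄ * η + c₅ * ε) := by
        by_contra hno
        rw [nextS, if_neg hno] at htS'
        exact htS htS'
      have hlt : C.card < cap := by
        by_contra hlt
        exact hfull ⟨hheavy, hlt⟩
      have hnear : ∃ c ∈ nextC ch cap w S C, hdist D t c ≤ 3 * (c₄ * η + c₅ * ε) := by
        refine ⟨ch.center w, ?_, ?_⟩
        · rw [nextC, if_pos ⟨hheavy, hlt⟩]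
          exact Finset.mem_insert_self _ _
        · rw [nextS, if_pos hheavy] at htS'
          exact (Finset.mem_filter.1 ((Finset.mem_union.1 htS').resolve_left htS)).2
      refine ofReal_le_prob_query κ t (g := fun _ _ => γ) (G := fun _ => γ) (integrable_const _)
        (fun x y => ofReal_le_prob_stageOne_of_near ch κ hfinish k _ _ _ _ hS' hC' hcard' hnear
          (by omega)) (fun x => le_of_eq (by ring)) ?_
      simp only [integral_const, probReal_univ, smul_eq_mul, one_mul]
      have := pow_nonneg he (k + 1)
      nlinarith
    · set Φ' := potential ch.packing w (nextS ch w S) t with hΦ'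
      have hΦ'1 : 1 ≤ Φ' := one_le_potential hw ht htS'
      set b := ((2 : ℝ) / 5) ^ (cap - (nextC ch cap w S C).card) with hb
      have hb'0 : 0 ≤ b := by positivity
      -- The factor `2/5` gained by capping pays for the place that the new center takes. If the
      -- center is already in `C`, no place is taken and the exponent only improves.
      have hcmp : Φ' ≤ potential ch.packing w S t ∧
          Φ' * b ≤ potential ch.packing w S t * (2 / 5) ^ (cap - C.card) := by
        by_cases hheavy : ∃ μ ∈ H, 4 / 5 < ballMass D ch.packing
            (capped (posterior ch.packing w) S) μ (c₄ * η + c₅ * ε)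
        · have hlt : C.card < cap := by
            by_contra hlt
            exact hfull ⟨hheavy, hlt⟩
          have h1 := potential_nextS_le ch hw ht htS hS hheavy
          have h2 : b ≤ (2 / 5) ^ (cap - (C.card + 1)) := by
            refine pow_le_pow_of_le_one (by norm_num) (by norm_num) ?_
            rw [nextC, if_pos ⟨hheavy, hlt⟩]
            exact Nat.sub_le_sub_left (Finset.card_insert_le _ _) _
          have h3 : ((2 : ℝ) / 5) ^ (cap - C.card) = (2 / 5) ^ (cap - (C.card + 1)) * (2 / 5) := by
            rw [← pow_succ]
            congr 1
            omega
          refine ⟨by linarith, ?_⟩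
          calc Φ' * b ≤ (2 / 5 * potential ch.packing w S t) * (2 / 5) ^ (cap - (C.card + 1)) :=
                mul_le_mul h1 h2 hb'0 (by linarith)
            _ = _ := by rw [h3]; ring
        · have e1 : nextS ch w S = S := by rw [nextS, if_neg hheavy]
          have e2 : nextC ch cap w S C = C := by
            rw [nextC, if_neg fun h => hheavy h.1]
          rw [hΦ', hb, e1, e2]
          exact ⟨le_rfl, le_rfl⟩
      have hF : ∀ h ∈ ch.packing, Measurable h := fun h hh => hmeas h (ch.packing_spec.1 hh)
      set A := Real.exp (-(β / 10)) ^ k + b with hA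
      have hA0 : 0 ≤ A := by positivity
      have hint : Integrable (fun x => 1 - 19 / 100 *
          disagreement ch.packing w (nextS ch w S) t x + 43 / 100 * noise κ t x)
          (ch.queryDist w (nextS ch w S)) :=
        ((integrable_const _).sub ((integrable_disagreement hF hw ht htS' hS' _).const_mul _)).add
          ((integrable_noise κ (hF t ht) _).const_mul _)
      refine ofReal_le_prob_query κ t
        (g := fun x y => γ + potential ch.packing (nextW ch.packing α w x y) (nextS ch w S) t * A)
        (G := fun x => γ + Φ' * A * (1 - 19 / 100 *
          disagreement ch.packing w (nextS ch w S) t x + 43 / 100 * noise κ t x))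
        ((integrable_const _).add (hint.const_mul _))
        (fun x y => ih _ _ _ _ (nextW_pos hw x y) hS' htS' hC' hcard' (by omega))
        (fun x => ?_) ?_
      · obtain ⟨h1, h2⟩ := potential_nextW_le hw ht htS' hS' hα x
        have hρ0 := noise_nonneg κ t x
        have hρ1 : 0 ≤ 1 - noise κ t x := sub_nonneg.2 (noise_le_one κ t x)
        have h3 := mean_update_le (disagreement_nonneg hw ht htS' hS' x)
          (disagreement_le_one hw ht htS' hS' x) hρ0
        have h4 := mul_le_mul_of_nonneg_left h3 (mul_nonneg (zero_le_one.trans hΦ'1) hA0)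
        have h5 := mul_le_mul_of_nonneg_left (mul_le_mul_of_nonneg_right h1 hA0) hρ1
        have h6 := mul_le_mul_of_nonneg_left (mul_le_mul_of_nonneg_right h2 hA0) hρ0
        linarith
      · rw [integral_add_const_mul hint]
        have h1 := integral_mean_update_le hmeas hη hc₄ hβ ch hval κ hw ht hterr hS htS'
        have h2 := mul_le_mul_of_nonneg_left h1 (mul_nonneg (zero_le_one.trans hΦ'1) hA0)
        have h3 : Φ' * A * Real.exp (-(β / 10)) =
            Φ' * Real.exp (-(β / 10)) ^ (k + 1) + Φ' * b * Real.exp (-(β / 10)) := by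
          rw [hA]; ring
        have h4 : Φ' * Real.exp (-(β / 10)) ^ (k + 1) ≤
            potential ch.packing w S t * Real.exp (-(β / 10)) ^ (k + 1) :=
          mul_le_mul_of_nonneg_right hcmp.1 (pow_nonneg he _)
        -- Only the first summand needs the contraction by a round; for the summand counting centers
        -- it is enough that the mean potential does not grow.
        have h5 : Φ' * b * Real.exp (-(β / 10)) ≤ Φ' * b * 1 :=
          mul_le_mul_of_nonneg_left he1 (mul_nonneg (zero_le_one.trans hΦ'1) hb'0)
        linarith [hcmp.2]

end ActiveLearning

namespace ActiveLearning

/-! ### Numerical estimates -/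

lemma one_le_logp (x : ℝ) : 1 ≤ logp x := le_max_left _ _

lemma log_le_logp (x : ℝ) : Real.log x ≤ logp x := le_max_right _ _

lemma logp_le_logp {x y : ℝ} (hx : 0 < x) (hxy : x ≤ y) : logp x ≤ logp y :=
  max_le_max le_rfl (Real.log_le_log hx hxy)

lemma mul_exp_neg_logp_le {n δ : ℝ} (hn : 0 < n) (hδ : 0 < δ) :
    n * Real.exp (-logp (n / δ)) ≤ δ := by
  have h1 : Real.exp (-logp (n / δ)) ≤ Real.exp (-Real.log (n / δ)) :=
    Real.exp_le_exp.2 (neg_le_neg (log_le_logp _))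
  rw [Real.exp_neg, Real.exp_neg, Real.exp_log (div_pos hn hδ), ← Real.exp_neg, inv_div] at h1
  rwa [le_div_iff₀ hn, mul_comm] at h1

lemma exp_neg_logp_le_half (x : ℝ) : Real.exp (-logp x) ≤ 1 / 2 := by
  have h1 : Real.exp (-logp x) ≤ Real.exp (-1) :=
    Real.exp_le_exp.2 (neg_le_neg (one_le_logp x))
  refine h1.trans ?_
  rw [Real.exp_neg, one_div]
  exact inv_anti₀ two_pos (by linarith [Real.exp_one_gt_d9])

/-- The failure probability of the first stage. -/
lemma sq_mul_add_le {n δ β : ℝ} {k c : ℕ} (hn : 1 ≤ n) (hδ : 0 < δ) (hδ1 : δ < 1) (hβ : 0 < β)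
    (hk : 50 * (1 / β) * logp (n / δ) ≤ k) (hc : 10 * logp (n / δ) ≤ c) :
    n ^ 2 * (Real.exp (-(β / 10)) ^ k + (2 / 5) ^ c) ≤ δ / 2 := by
  have hne := mul_exp_neg_logp_le (zero_lt_one.trans_le hn) hδ
  have he := exp_neg_logp_le_half (n / δ)
  -- With `L = logp (n / δ)`, both `50` (at rate `β/10`) and `10` (at rate `1/2`, as `2/5 ≤
  -- exp(-1/2)`) give `exp(-5L)`. Two of the five factors absorb `n ^ 2` and leave `δ`; the other
  -- three are at most `1/2` each.
  have h5 : Real.exp (-(5 * logp (n / δ))) = Real.exp (-logp (n / δ)) ^ 5 := by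
    rw [← Real.exp_nat_mul]
    congr 1
    push_cast
    ring
  have h1 : Real.exp (-(β / 10)) ^ k ≤ Real.exp (-logp (n / δ)) ^ 5 := by
    rw [← h5, ← Real.exp_nat_mul]
    refine Real.exp_le_exp.2 ?_
    have := mul_le_mul_of_nonneg_left hk hβ.le
    have e : β * (50 * (1 / β) * logp (n / δ)) = 50 * logp (n / δ) := by field_simp
    rw [e] at this
    linarith
  have h2 : ((2 : ℝ) / 5) ^ c ≤ Real.exp (-logp (n / δ)) ^ 5 := by
    have h : (2 : ℝ) / 5 ≤ Real.exp (-(1 / 2)) := by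
      linarith [Real.add_one_le_exp (-(1 / 2 : ℝ))]
    refine (pow_le_pow_left₀ (by norm_num) h c).trans ?_
    rw [← h5, ← Real.exp_nat_mul]
    refine Real.exp_le_exp.2 ?_
    linarith
  have hpos := Real.exp_pos (-logp (n / δ))
  generalize Real.exp (-logp (n / δ)) = e at *
  have hne0 : 0 ≤ n * e := mul_nonneg (by linarith) hpos.le
  have h3 : (n * e) ^ 2 ≤ δ := by nlinarith
  have h4 : e ^ 3 ≤ (1 / 2) ^ 3 := pow_le_pow_left₀ hpos.le he 3
  calc n ^ 2 * (Real.exp (-(β / 10)) ^ k + (2 / 5) ^ c) ≤ n ^ 2 * (e ^ 5 + e ^ 5) :=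
        mul_le_mul_of_nonneg_left (add_le_add h1 h2) (sq_nonneg n)
    _ = 2 * ((n * e) ^ 2 * e ^ 3) := by ring
    _ ≤ 2 * (δ * (1 / 2) ^ 3) :=
        mul_le_mul_of_nonneg_left (mul_le_mul h3 h4 (by positivity) hδ.le) two_pos.le
    _ ≤ δ / 2 := by linarith

/-- The failure probability of the second stage. -/
lemma card_mul_pow_le {c δ g : ℝ} {m : ℕ} (hc : 0 < c) (hδ : 0 < δ) (hg : 0 < g)
    (hg2 : g < 1 / 2) (hm : 1 / g ^ 2 * logp (c / δ) ≤ m) :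
    c * (1 - 2 * g ^ 2) ^ m ≤ δ / 2 := by
  have hne := mul_exp_neg_logp_le hc hδ
  have he := exp_neg_logp_le_half (c / δ)
  -- Of the two factors `exp(-logp (c / δ))`, one absorbs the union bound over `c` comparisons and
  -- the other provides the `1/2`.
  have h1 : (1 - 2 * g ^ 2) ^ m ≤ Real.exp (-logp (c / δ)) ^ 2 := by
    have h : 1 - 2 * g ^ 2 ≤ Real.exp (-(2 * g ^ 2)) := by
      linarith [Real.add_one_le_exp (-(2 * g ^ 2))]
    refine (pow_le_pow_left₀ (by nlinarith) h m).trans ?_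
    rw [← Real.exp_nat_mul, ← Real.exp_nat_mul]
    refine Real.exp_le_exp.2 ?_
    have := mul_le_mul_of_nonneg_left hm (sq_nonneg g)
    have e : g ^ 2 * (1 / g ^ 2 * logp (c / δ)) = logp (c / δ) := by field_simp
    rw [e] at this
    push_cast
    linarith
  have hpos := Real.exp_pos (-logp (c / δ))
  generalize Real.exp (-logp (c / δ)) = e at *
  calc c * (1 - 2 * g ^ 2) ^ m ≤ c * e ^ 2 := mul_le_mul_of_nonneg_left h1 hc.le
    _ = (c * e) * e := by ring
    _ ≤ δ * (1 / 2) := mul_le_mul hne he hpos.le hδ.le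
    _ = δ / 2 := by ring

lemma logp_div_le {N δ : ℝ} (hN : 0 < N) (hδ : 0 < δ) (hδ1 : δ < 1) :
    logp (N / δ) ≤ logp N / δ := by
  have h1 : 1 ≤ 1 / δ := by rw [le_div_iff₀ hδ]; linarith
  have h2 := one_le_logp N
  have h3 : logp N + (1 / δ - 1) ≤ logp N / δ := by
    have e : logp N / δ = logp N * (1 / δ) := by ring
    rw [e]
    nlinarith
  refine max_le (by linarith) ?_
  have h4 : Real.log (N / δ) = Real.log N + Real.log (1 / δ) := by
    rw [← Real.log_mul hN.ne' (by positivity), mul_one_div]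
  have h5 := Real.log_le_sub_one_of_pos (show 0 < 1 / δ by positivity)
  linarith [log_le_logp N]

/-- Since `logp (N / δ) ≤ logp N / δ`, the quotient `c / δ` is at most `11 (logp N / δ)²`; the
logarithm turns the square into a factor `2` and adds `log 11 ≤ 3`. -/
lemma logp_card_div_le {c N δ : ℝ} (hc : 0 < c) (hN : 0 < N) (hδ : 0 < δ) (hδ1 : δ < 1)
    (hcN : c ≤ 11 * logp (N / δ)) : logp (c / δ) ≤ 5 * logp (logp N / δ) := by
  have h1 := one_le_logp (logp N / δ)
  have hA : 0 < logp N / δ := div_pos (zero_lt_one.trans_le (one_le_logp N)) hδ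
  refine max_le (by linarith) ?_
  have h2 : c / δ ≤ 11 * (logp N / δ) ^ 2 := by
    have h3 := logp_div_le hN hδ hδ1
    have h4 : 1 / δ ≤ logp N / δ := div_le_div_of_nonneg_right (one_le_logp N) hδ.le
    calc c / δ = c * (1 / δ) := by ring
      _ ≤ (11 * (logp N / δ)) * (logp N / δ) :=
          mul_le_mul (by linarith) h4 (by positivity) (by linarith)
      _ = _ := by ring
  have h11 : Real.log 11 ≤ 3 := by
    rw [Real.log_le_iff_le_exp (by norm_num)]
    have e : Real.exp 3 = Real.exp 1 ^ 3 := by rw [← Real.exp_nat_mul]; norm_num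
    rw [e]
    have := pow_le_pow_left₀ (by norm_num) Real.exp_one_gt_d9.le 3
    norm_num at this
    linarith
  calc Real.log (c / δ) ≤ Real.log (11 * (logp N / δ) ^ 2) := Real.log_le_log (div_pos hc hδ) h2
    _ = Real.log 11 + 2 * Real.log (logp N / δ) := by
        rw [Real.log_mul (by norm_num) (by positivity), Real.log_pow]; norm_num
    _ ≤ 5 * logp (logp N / δ) := by linarith [log_le_logp (logp N / δ)]

/-- The number of queries of the two stages. -/
lemma queries_le {n N c : ℕ} {δ β s : ℝ} (hn : 0 < n) (hnN : n ≤ N) (hδ : 0 < δ) (hδ1 : δ < 1)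
    (hβ : 0 < β) (hs : 0 < s) (hc : 0 < c) (hcap : c ≤ ⌈10 * logp (n / δ)⌉₊) :
    ((⌈50 * (1 / β) * logp (n / δ)⌉₊ + c * ⌈s * logp (c / δ)⌉₊ : ℕ) : ℝ) ≤
      56 * (s + 1) * (1 / β * logp (N / δ) + logp (N / δ) * logp (logp N / δ)) := by
  have hn0 : (0 : ℝ) < n := Nat.cast_pos.2 hn
  have hN0 : (0 : ℝ) < N := Nat.cast_pos.2 (hn.trans_le hnN)
  have hc0 : (0 : ℝ) < c := Nat.cast_pos.2 hc
  have hL : logp (n / δ) ≤ logp (N / δ) :=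
    logp_le_logp (div_pos hn0 hδ) (div_le_div_of_nonneg_right (Nat.cast_le.2 hnN) hδ.le)
  have hL1 := one_le_logp (N / δ)
  have hL0 := one_le_logp ((n : ℝ) / δ)
  have hc11 : (c : ℝ) ≤ 11 * logp (N / δ) := by
    have h1 : (c : ℝ) ≤ ⌈10 * logp (n / δ)⌉₊ := Nat.cast_le.2 hcap
    have h2 := (Nat.ceil_lt_add_one (show 0 ≤ 10 * logp ((n : ℝ) / δ) by linarith)).le
    linarith
  have hLL := logp_card_div_le hc0 hN0 hδ hδ1 hc11
  have hLL1 := one_le_logp (logp N / δ)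
  have hlc := one_le_logp ((c : ℝ) / δ)
  have hB : 0 < 1 / β := by positivity
  have hk : (⌈50 * (1 / β) * logp (n / δ)⌉₊ : ℝ) ≤ 50 * (1 / β * logp (N / δ)) + 1 := by
    have h1 := (Nat.ceil_lt_add_one
      (show 0 ≤ 50 * (1 / β) * logp ((n : ℝ) / δ) by positivity)).le
    have h2 := mul_le_mul_of_nonneg_left hL hB.le
    linarith
  have hm : (⌈s * logp (c / δ)⌉₊ : ℝ) ≤ (s + 1) * (5 * logp (logp N / δ)) := by
    have h1 := (Nat.ceil_lt_add_one (show 0 ≤ s * logp ((c : ℝ) / δ) by positivity)).le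
    have h2 := mul_le_mul_of_nonneg_left hLL (by linarith : 0 ≤ s + 1)
    linarith
  have hcm := mul_le_mul hc11 hm (Nat.cast_nonneg _) (by linarith)
  have hP : 0 < 1 / β * logp (N / δ) := by positivity
  have hQ : 1 ≤ logp (N / δ) * logp (logp N / δ) := one_le_mul_of_one_le_of_one_le hL1 hLL1
  push_cast
  have e : 11 * logp (N / δ) * ((s + 1) * (5 * logp (logp N / δ))) =
      55 * ((s + 1) * (logp (N / δ) * logp (logp N / δ))) := by ring
  rw [e] at hcm
  -- `55 = 11 · 5` comes from the second stage; the extra unit in `56` absorbs the rounding of the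
  -- number of rounds, as the second summand is at least `1`.
  nlinarith [mul_pos hs hP, mul_pos hs (zero_lt_one.trans_le hQ)]

end ActiveLearning

/-! ### The theorem: choice of the constants and combination of the two stages -/

theorem theorem3 (c₁ c₄ c₅ : ℝ) (hc₄ : 300 ≤ c₄) (hc₅ : c₅ = 1 / 10)
    (hc₁ : 90 * c₄ + 80 < c₁) :
    ∃ (p : ActiveLearning.Constants) (K : ℝ),
      0 < p.α ∧ 0 < p.rounds ∧ 0 < p.centers ∧ 0 < p.samples ∧ 0 < K ∧
      ∀ (X : Type*) [MeasurableSpace X] (D : MeasureTheory.Measure X)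
        [MeasureTheory.IsProbabilityMeasure D] (H : Set (X → Bool)) (η ε δ β : ℝ),
        H.Nonempty → (∀ h ∈ H, Measurable h) → (∃ F, ActiveLearning.IsCover D H η F) →
        0 ≤ η → c₁ * η ≤ ε → 0 < δ → δ < 1 → 0 < β →
        ActiveLearning.HasQueryValue D H c₄ c₅ η ε β →
        Nonempty (ActiveLearning.Choices D H η (c₄ * η + c₅ * ε) (c₄ / 20 * η)
          (ActiveLearning.threshold η ε (c₄ * η + c₅ * ε))) ∧
        ∀ ch : ActiveLearning.Choices D H η (c₄ * η + c₅ * ε) (c₄ / 20 * η)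
          (ActiveLearning.threshold η ε (c₄ * η + c₅ * ε)),
          ActiveLearning.Solves (ActiveLearning.algorithm ch p β δ) H D η ε δ
            (K * (1 / β * ActiveLearning.logp (ActiveLearning.coverNumber D H η / δ) +
              ActiveLearning.logp (ActiveLearning.coverNumber D H η / δ) *
                ActiveLearning.logp
                  (ActiveLearning.logp (ActiveLearning.coverNumber D H η) / δ))) := by
  have hc₁0 : 0 < c₁ := by linarith
  -- the margin by which the error of the good center stays below half of the threshold
  obtain ⟨g, hg⟩ : ∃ g : ℝ, g = 1 / 20 - (4 + 9 / 2 * c₄) / c₁ := ⟨_, rfl⟩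
  have hgc : g * c₁ = c₁ / 20 - (4 + 9 / 2 * c₄) := by rw [hg]; field_simp
  -- With `c₅ = 1/10`, half of the threshold exceeds `3η + 3R` by `ε/20 - (4 + 9/2 c₄) η`. This is
  -- at least `g ε` for `ε ≥ c₁ η`, and `g` is positive exactly when `c₁ > 90 c₄ + 80`.
  have hg0 : 0 < g := by
    by_contra h
    nlinarith
  have hg1 : g ≤ 1 / 20 := by
    have : 0 ≤ (4 + 9 / 2 * c₄) / c₁ := by positivity
    linarith
  have hα : Real.exp (-(-Real.log (9 / 10))) = 9 / 10 := by
    rw [neg_neg, Real.exp_log (by norm_num)]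
  have hs : 0 < 1 / g ^ 2 := by positivity
  refine ⟨⟨-Real.log (9 / 10), 50, 10, 1 / g ^ 2⟩, 56 * (1 / g ^ 2 + 1),
    neg_pos.2 (Real.log_neg (by norm_num) (by norm_num)), by norm_num, by norm_num, hs,
    by positivity, ?_⟩
  intro X _ D _ H η ε δ β hH hmeas hcov hη hε hδ hδ1 hβ hval
  refine ⟨ActiveLearning.nonempty_choices hH hmeas hcov _ (by positivity) _, ?_⟩
  intro ch κ _ ⟨h, hh, herr⟩
  obtain ⟨t, ht, htd⟩ := ch.packing_spec.exists_near (by linarith) hh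
  have hF : ∀ f ∈ ch.packing, f ∈ H := fun f hf => ch.packing_spec.1 hf
  have hterr : ActiveLearning.err D κ t ≤ 3 * η := by
    have := ActiveLearning.err_le_err_add_hdist (D := D) κ (hmeas t (hF t ht)) (hmeas h hh)
    linarith
  have hn : 0 < ch.packing.card := Finset.card_pos.2 ⟨t, ht⟩
  have hnN := ch.packing_spec.card_le_coverNumber hcov
  subst hc₅
  have hηε : 90 * c₄ * η + 80 * η ≤ ε := by nlinarith
  have hc₄η : 300 * η ≤ c₄ * η := mul_le_mul_of_nonneg_right hc₄ hη
  have hT : 0 ≤ ActiveLearning.threshold η ε (c₄ * η + 1 / 10 * ε) := by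
    rw [ActiveLearning.threshold]
    linarith
  rw [ActiveLearning.algorithm]
  have hmain := ActiveLearning.ofReal_le_prob_stageOne (N := ⌈50 * (1 / β) *
      ActiveLearning.logp (ch.packing.card / δ)⌉₊)
    (E := fun h n => (n : ℝ) ≤ 56 * (1 / g ^ 2 + 1) *
      (1 / β * ActiveLearning.logp (ActiveLearning.coverNumber D H η / δ) +
        ActiveLearning.logp (ActiveLearning.coverNumber D H η / δ) *
          ActiveLearning.logp (ActiveLearning.logp (ActiveLearning.coverNumber D H η) / δ)) ∧
      h ∈ H ∧ ActiveLearning.err D κ h ≤ η + ε)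
    (cap := ⌈10 * ActiveLearning.logp (ch.packing.card / δ)⌉₊)
    (finish := fun C => ActiveLearning.stageTwo ch
      ⌈1 / g ^ 2 * ActiveLearning.logp (C.card / δ)⌉₊ C.card C)
    hmeas hη hc₄ hβ.le ch hval κ ht hterr hα (by linarith : 0 ≤ δ / 2) ?_
    ⌈50 * (1 / β) * ActiveLearning.logp (ch.packing.card / δ)⌉₊ (fun _ => 1) ∅ ∅ 0
    (fun _ _ => one_pos) (Finset.empty_subset _) (Finset.notMem_empty _) (by simp) (by simp)
    (zero_add _)
  · refine (ENNReal.ofReal_le_ofReal ?_).trans hmain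
    -- Under uniform weights with nothing capped, `t` has mass `1 / |H'|` in both factors.
    have hpot : ActiveLearning.potential ch.packing (fun _ => 1) ∅ t =
        (ch.packing.card : ℝ) ^ 2 := by
      simp [ActiveLearning.potential, ActiveLearning.freeWeight, sq]
    rw [hpot, Finset.card_empty, Nat.sub_zero]
    have := ActiveLearning.sq_mul_add_le (n := ch.packing.card) (Nat.one_le_cast.2 hn) hδ hδ1 hβ
      (Nat.le_ceil _) (Nat.le_ceil (10 * ActiveLearning.logp (ch.packing.card / δ)))
    linarith
  · rintro C hCH hcard ⟨c, hcC, hct⟩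
    have hC0 : 0 < C.card := Finset.card_pos.2 ⟨c, hcC⟩
    have hcerr : ActiveLearning.err D κ c ≤ 3 * η + 3 * (c₄ * η + 1 / 10 * ε) := by
      have := ActiveLearning.err_le_err_add_hdist (D := D) κ (hmeas c (hCH hcC))
        (hmeas t (hF t ht))
      linarith
    have hmargin : ActiveLearning.err D κ c ≤
        (1 / 2 - g) * ActiveLearning.threshold η ε (c₄ * η + 1 / 10 * ε) := by
      rw [ActiveLearning.threshold]
      have h1 := mul_le_mul_of_nonneg_left hε hg0.le
      have h2 : g * c₁ * η = (c₁ / 20 - (4 + 9 / 2 * c₄)) * η := by rw [hgc]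
      have h3 : 0 ≤ g * η := mul_nonneg hg0.le hη
      have h4 : 0 ≤ g * (c₄ * η) := mul_nonneg hg0.le (by linarith)
      have h5 := mul_le_mul_of_nonneg_right hg1 (show 0 ≤ ε - c₁ * η by linarith)
      have h6 : 0 ≤ ε := by linarith
      have h7 : 0 ≤ g * ε := mul_nonneg hg0.le h6
      linarith
    have h2 := ActiveLearning.ofReal_le_prob_stageTwo hmeas ch κ hT hg0 (by linarith) hmargin
      (B := η + ε) (by rw [ActiveLearning.threshold]; linarith)
      ⌈1 / g ^ 2 * ActiveLearning.logp (C.card / δ)⌉₊ C.card C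
      ⌈50 * (1 / β) * ActiveLearning.logp (ch.packing.card / δ)⌉₊ hCH hcC le_rfl
      (ActiveLearning.queries_le hn hnN hδ hδ1 hβ hs hC0 hcard)
    refine (ENNReal.ofReal_le_ofReal ?_).trans h2
    have := ActiveLearning.card_mul_pow_le (c := C.card) (Nat.cast_pos.2 hC0) hδ hg0
      (by linarith) (Nat.le_ceil (1 / g ^ 2 * ActiveLearning.logp (C.card / δ)))
    linarith
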